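/- Let $K$ be an algebraically closed field and let $\Gamma$ be a Dynkin diagram of type $A_n$ ($n\ge 1$), $D_n$ ($n\ge 4$) or $E_n$ ($n=6,7,8$) with vertices $1,\dots,n$, numbered so that $A_n$ is the chain $1-2-\cdots-n$; in type $D_n$ the vertices $1,\dots,n-1$ form a chain and $n$ is joined to $n-2$; in type $E_n$ the vertices $1,\dots,n-1$ form a chain and $n$ is joined to $3$. Let $s_{ij}=1$ if $i,j$ are adjacent and $i>j$, $s_{ij}=-1$ if they are adjacent and $i<j$, and $s_{ij}=0$ otherwise. Fix polynomials $P'_1,\dots,P'_n\in K[x]$ and write $P'=(P'_1,\dots,P'_n)$. A representation $V$ of the $N=1$ ADE quiver $(\Gamma,P')$ consists of finite-dimensional $K$-vector spaces $V(i)$, linear maps $\Phi_i:V(i)\to V(i)$ for all $i$, and linear maps $Q_{ij}:V(j)\to V(i)$ for all adjacent $i,j$, such that $$\sum_i s_{ij}Q_{ji}Q_{ij}+P'_j(\Phi_j)=0\ \text{ for all } j,\qquad Q_{ij}\Phi_j=\Phi_iQ_{ij}\ \text{ for all adjacent } i,j .$$ Simple and indecomposable representations are defined as usual (both are nonzero),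 and $\dim V=(\dim V(i))_i\in\mathbb Z^n$. Finite representation type means that there are only finitely many isomorphism classes of indecomposable representations. Let $e_1,\dots,e_n$ be the standard basis of $\mathbb Z^n$ (the simple roots), let $\sigma_k$ be the reflection with $(\sigma_kx)_k=-x_k+\sum_{l\text{ adjacent to }k}x_l$ and $(\sigma_kx)_i=x_i$ for $i\neq k$, and let $\mathfrak W$ be the Weyl group generated by the $\sigma_k$. The positive roots are the vectors $we_j$ ($w\in\mathfrak W$, $1\le j\le n$) with nonnegative coordinates. For $w\in\mathfrak W$ with $we_j=\sum_i m_ie_i$ put $w(P')_j=\sum_i m_iP'_i$. In particular $\sigma_k(P')_j=P'_j+P'_k$ for $j$ adjacent to $k$, $\sigma_k(P')_k=-P'_k$, and $\sigma_k(P')_j=P'_j$ for all other $j$. Reflection functors: let $k$ be a vertex and let $V$ be a simple representation of $(\Gamma,P')$ not concentrated at $k$, on which every $\Phi_i$ is multiplication by a scalar $\lambda$ with $P'_k(\lambda)\ne0$. Let $h:\bigoplus_{i\text{ adj. }k}V(i)\to V(k)$, $h((x_i))=\sum_i s_{ik}Q_{ki}x_i$, and $g:V(k)\to\bigoplus_{i\text{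 adj. }k}V(i)$, $g(x)=(Q_{ik}x)_i$. Then the composite $\varphi:\ker h\hookrightarrow\bigoplus_i V(i)\twoheadrightarrow\operatorname{coker}g$ is an isomorphism. The representation $F_k(V)$ of $(\Gamma,\sigma_k(P'))$ has $F_k(V)(k)=\ker h$ and $F_k(V)(i)=V(i)$ for $i\ne k$; all $\Phi_i$ are multiplication by $\lambda$; the maps $Q'_{ij}$ with $i,j\neq k$ are the old ones; for $i$ adjacent to $k$, $Q'_{ik}((x_j)_j)=-s_{ki}x_i$, and $Q'_{ki}=P'_k(\lambda)\,\varphi^{-1}\circ\big(V(i)\hookrightarrow\bigoplus_jV(j)\twoheadrightarrow\operatorname{coker}g\big)$. **Theorem.** Assume that no polynomial $w(P')_j$ ($w\in\mathfrak W$, $1\le j\le n$) has a multiple root in $K$ (the zero polynomial counts as having multiple roots), and assume (*) if $m,m'\in\mathbb Z^n\setminus\{0\}$ are such that $\sum_i m_iP'_i$ and $\sum_i m'_iP'_i$ have a common root in $K$, then there is a constant $c\in\mathbb Q$ with $m'_i=cm_i$ for all $i$. Then $(\Gamma,P')$ has finite representation type. Moreover, for every simple representation $V$ of $(\Gamma,P')$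 there are $\lambda\in K$, vertices $\beta_1,\dots,\beta_r$ ($r\ge0$) and $\beta$, and a simple representation $L_\beta$ of $(\Gamma,\sigma_{\beta_r}(\cdots\sigma_{\beta_1}(P')\cdots))$ concentrated at the vertex $\beta$, on which all $\Phi_i$ are multiplication by $\lambda$, such that $$V\cong F_{\beta_1}\cdots F_{\beta_r}(L_\beta),$$ where each functor in turn is applied to a simple representation satisfying the conditions above for it to be defined; and $\dim V=\sigma_{\beta_1}\cdots\sigma_{\beta_r}(e_\beta)$, which is a positive root of $\Gamma$. -/

import Mathlib

open Polynomial

universe u v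

/-! ### The simply laced Dynkin diagrams -/

/-- The types `A_n` (`n ≥ 1`), `D_n` (`n ≥ 4`), `E_n` (`n = 6, 7, 8`). -/
inductive ADEDiagram : Type
  | A (n : ℕ) (hn : 1 ≤ n) : ADEDiagram
  | D (n : ℕ) (hn : 4 ≤ n) : ADEDiagram
  | E (n : ℕ) (hn : 6 ≤ n) (hn' : n ≤ 8) : ADEDiagram

namespace ADEDiagram

/-- The number of vertices. -/
def rank : ADEDiagram → ℕ
  | A n _ => n
  | D n _ => n
  | E n _ _ => n

/-- `a — b` is an edge whose smaller end is `a`; the vertices `1, …, n` are numbered `0, …, n - 1`.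
`A_n` is a chain; in `D_n` (resp. `E_n`) the vertices `1, …, n - 1` form a chain, and the vertex `n`
is joined to the vertex `n - 2` (resp. to the vertex `3`). -/
def edge : ADEDiagram → ℕ → ℕ → Prop
  | A n _, a, b => a + 1 = b ∧ b < n
  | D n _, a, b => (a + 1 = b ∧ b + 1 < n) ∨ (a + 3 = n ∧ b + 1 = n)
  | E n _ _, a, b => (a + 1 = b ∧ b + 1 < n) ∨ (a = 2 ∧ b + 1 = n)

instance (Γ : ADEDiagram) (a b : ℕ) : Decidable (Γ.edge a b) := by
  cases Γ <;> (dsimp only [edge]; infer_instance)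

theorem edge_irrefl (Γ : ADEDiagram) (a : ℕ) : ¬ Γ.edge a a := by
  cases Γ <;> (dsimp only [edge]; omega)

/-- The Dynkin diagram as a graph on its vertices. -/
def graph (Γ : ADEDiagram) : SimpleGraph (Fin Γ.rank) where
  Adj i j := Γ.edge i j ∨ Γ.edge j i
  symm := ⟨fun _ _ h => Or.symm h⟩
  loopless := ⟨fun i h => h.elim (Γ.edge_irrefl i) (Γ.edge_irrefl i)⟩

instance (Γ : ADEDiagram) : DecidableRel Γ.graph.Adj := fun i j =>
  inferInstanceAs (Decidable (Γ.edge i j ∨ Γ.edge j i))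

end ADEDiagram

namespace NOneQuiver

variable {n : ℕ}

section Weyl

/-! ### Weyl group, roots, and the action on tuples of polynomials -/

variable (G : SimpleGraph (Fin n)) [DecidableRel G.Adj]

/-- The map `σ_k`: `(σ_k x)_k = - x_k + ∑_{l adjacent to k} x_l`, and `(σ_k x)_i = x_i` for `i ≠ k`. -/
def simpleReflectionMap (k : Fin n) : (Fin n → ℤ) →ₗ[ℤ] (Fin n → ℤ) where
  toFun x := Function.update x k (-x k + ∑ l : {i // G.Adj k i}, x l)
  map_add' x y := by
    funext i
    by_cases h : i = k
    · subst h
      simp [Finset.sum_add_distrib]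
      ring
    · simp [h]
  map_smul' c x := by
    funext i
    by_cases h : i = k
    · subst h
      simp only [Pi.smul_apply, smul_eq_mul, Function.update_self, RingHom.id_apply,
        ← Finset.mul_sum]
      ring
    · simp [h]

theorem simpleReflectionMap_involutive (k : Fin n) :
    Function.Involutive (simpleReflectionMap G k) := by
  intro x
  have hne : ∀ l : {i // G.Adj k i}, (l : Fin n) ≠ k := fun l => (G.ne_of_adj l.2).symm
  funext i
  by_cases h : i = k
  · subst h
    simp [simpleReflectionMap, hne]
  · simp [simpleReflectionMap, h]

/-- The simple reflection `σ_k` as an automorphism of the root lattice `ℤⁿ`; in terms of the basis of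
simple roots, `σ_k e_j = e_j + e_k` for `j` adjacent to `k`, `σ_k e_k = - e_k`, and `σ_k e_j = e_j`
otherwise. -/
def simpleReflection (k : Fin n) : (Fin n → ℤ) ≃ₗ[ℤ] (Fin n → ℤ) :=
  LinearEquiv.ofInvolutive (simpleReflectionMap G k) (simpleReflectionMap_involutive G k)

/-- The Weyl group. -/
def weylGroup : Subgroup ((Fin n → ℤ) ≃ₗ[ℤ] (Fin n → ℤ)) :=
  Subgroup.closure (Set.range (simpleReflection G))

/-- The simple root at the vertex `j`. -/
def simpleRoot (j : Fin n) : Fin n → ℤ := Pi.single j 1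

/-- Positive roots: the vectors in the Weyl group orbits of the simple roots that have nonnegative
coordinates. -/
def IsPositiveRoot (d : Fin n → ℤ) : Prop :=
  (∃ w ∈ weylGroup G, ∃ j, d = w (simpleRoot j)) ∧ ∀ i, 0 ≤ d i

variable {K : Type u} [Field K]

/-- The integer combination `∑ mᵢ Pᵢ`. -/
noncomputable def comb (P : Fin n → K[X]) (m : Fin n → ℤ) : K[X] := ∑ i, m i • P i

/-- The action on a tuple of polynomials by formal substitution: if `w e_j = ∑ mᵢ eᵢ` then the `j`-th
polynomial of the new tuple is `∑ mᵢ Pᵢ`. For `w = σ_k` this replaces `P_j` by `P_j + P_k` for `j`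
adjacent to `k`, and `P_k` by `- P_k`. -/
noncomputable def weylAct (w : (Fin n → ℤ) ≃ₗ[ℤ] (Fin n → ℤ)) (P : Fin n → K[X]) : Fin n → K[X] :=
  fun j => comb P (w (simpleRoot j))

/-- The set of all polynomials `w(P_j)`, for `w` in the Weyl group and `j` a vertex. -/
def weylPolynomials (P : Fin n → K[X]) : Set K[X] :=
  {p | ∃ w ∈ weylGroup G, ∃ j, p = weylAct w P j}

/-- `p` has a multiple root in `K` (the zero polynomial has multiple roots). -/
def HasMultipleRoot (p : K[X]) : Prop := ∃ a : K, (X - C a) ^ 2 ∣ p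

/-- The genericity condition: two nontrivial integer combinations of the `Pᵢ` have no common root
unless their coefficient vectors are proportional. -/
def Generic (P : Fin n → K[X]) : Prop :=
  ∀ m m' : Fin n → ℤ, m ≠ 0 → m' ≠ 0 →
    (∃ x : K, (comb P m).IsRoot x ∧ (comb P m').IsRoot x) →
    ∃ c : ℚ, ∀ i, (m' i : ℚ) = c * m i

end Weyl

/-! ### Representations -/

/-- A representation of the directed graph with two opposite arrows for each edge of `G` and a loop at
each vertex: spaces `V(i)`, maps `Φ_i : V(i) → V(i)`, and maps `Q_{ij} : V(j) → V(i)` for adjacent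
`i, j`. The relations are imposed by a separate predicate. -/
structure Rep (K : Type u) [Field K] (G : SimpleGraph (Fin n)) where
  V : Fin n → Type v
  [addCommGroup : ∀ i, AddCommGroup (V i)]
  [module : ∀ i, Module K (V i)]
  Φ : ∀ i, V i →ₗ[K] V i
  Q : ∀ i j, G.Adj i j → (V j →ₗ[K] V i)

attribute [instance] Rep.addCommGroup Rep.module

namespace Rep

section Basic

variable {K : Type u} [Field K] {G : SimpleGraph (Fin n)}

/-- All the spaces are finite-dimensional. -/
def FinDim (R : Rep.{u, v} K G) : Prop := ∀ i, FiniteDimensional K (R.V i)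

/-- The dimension vector. -/
noncomputable def dimVec (R : Rep.{u, v} K G) : Fin n → ℤ := fun i => (Module.finrank K (R.V i) : ℤ)

/-- A family of subspaces is a subrepresentation if it is stable under all the maps. -/
def IsSubrep (R : Rep.{u, v} K G) (U : ∀ i, Submodule K (R.V i)) : Prop :=
  (∀ i, ∀ x ∈ U i, R.Φ i x ∈ U i) ∧ ∀ i j (h : G.Adj i j), ∀ x ∈ U j, R.Q i j h x ∈ U i

/-- Some space is nonzero. -/
def IsNonzero (R : Rep.{u, v} K G) : Prop := ∃ i, Nontrivial (R.V i)

/-- Nonzero, and the only subrepresentations are zero and the whole. -/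
def IsSimple (R : Rep.{u, v} K G) : Prop :=
  R.IsNonzero ∧ ∀ U, R.IsSubrep U → (∀ i, U i = ⊥) ∨ (∀ i, U i = ⊤)

/-- Nonzero, and not the internal direct sum of two nonzero subrepresentations. -/
def IsIndecomposable (R : Rep.{u, v} K G) : Prop :=
  R.IsNonzero ∧ ∀ U W, R.IsSubrep U → R.IsSubrep W → (∀ i, IsCompl (U i) (W i)) →
    (∀ i, U i = ⊥) ∨ (∀ i, W i = ⊥)

/-- Concentrated at the vertex `k`: all the other spaces vanish. -/
def IsConcentratedAt (R : Rep.{u, v} K G) (k : Fin n) : Prop := ∀ i, i ≠ k → Subsingleton (R.V i)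

/-- Every `Φ_i` is multiplication by `lam`. -/
def IsScalar (R : Rep.{u, v} K G) (lam : K) : Prop := ∀ i x, R.Φ i x = lam • x

/-- The two representations are isomorphic. -/
def IsIsomorphic (R S : Rep.{u, v} K G) : Prop :=
  ∃ e : ∀ i, R.V i ≃ₗ[K] S.V i, (∀ i x, e i (R.Φ i x) = S.Φ i (e i x)) ∧
    ∀ i j (h : G.Adj i j) x, e i (R.Q i j h x) = S.Q i j h (e j x)

end Basic

section Relations

variable {K : Type u} [Field K] {G : SimpleGraph (Fin n)} [DecidableRel G.Adj]

/-- The sign `s_{ij}`: `1` if `i, j` are adjacent and `i > j`, `-1` if they are adjacent and `i < j`,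
and `0` if they are not adjacent. -/
def sgn (K : Type u) [Field K] (G : SimpleGraph (Fin n)) [DecidableRel G.Adj] (i j : Fin n) : K :=
  if G.Adj i j then (if j < i then 1 else -1) else 0

/-- The relations `∑ᵢ s_{ij} Q_{ji} Q_{ij} + P_j(Φ_j) = 0` and `Q_{ij} Φ_j = Φ_i Q_{ij}`. -/
def Satisfies (R : Rep.{u, v} K G) (P : Fin n → K[X]) : Prop :=
  (∀ j, ∑ i : {i // G.Adj j i}, sgn K G i j • (R.Q j i i.2 ∘ₗ R.Q i j i.2.symm)
      + aeval (R.Φ j) (P j) = 0) ∧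
  ∀ i j (h : G.Adj i j), R.Q i j h ∘ₗ R.Φ j = R.Φ i ∘ₗ R.Q i j h

/-! ### The modified reflection functors -/

/-- The space `⨁ V(i)` over the vertices `i` adjacent to `k`. -/
abbrev Nbr (R : Rep.{u, v} K G) (k : Fin n) : Type v := ∀ i : {i // G.Adj k i}, R.V i

/-- `h : ⨁ V(i) → V(k)`, `(xᵢ) ↦ ∑ s_{ik} Q_{ki} xᵢ`. -/
def inMap (R : Rep.{u, v} K G) (k : Fin n) : R.Nbr k →ₗ[K] R.V k :=
  ∑ i : {i // G.Adj k i}, sgn K G i k • (R.Q k i i.2 ∘ₗ LinearMap.proj i)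

/-- `g : V(k) → ⨁ V(i)`, `x ↦ (Q_{ik} x)`. -/
def outMap (R : Rep.{u, v} K G) (k : Fin n) : R.V k →ₗ[K] R.Nbr k :=
  LinearMap.pi fun i => R.Q i k i.2.symm

/-- `F⁺_k(V)(k) = ker h`. -/
abbrev Plus (R : Rep.{u, v} K G) (k : Fin n) : Type v := LinearMap.ker (R.inMap k)

/-- `F⁻_k(V)(k) = coker g`. -/
abbrev Minus (R : Rep.{u, v} K G) (k : Fin n) : Type v := R.Nbr k ⧸ LinearMap.range (R.outMap k)

/-- The natural map `φ : F⁺_k(V)(k) → F⁻_k(V)(k)`, the inclusion followed by the projection. -/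
def plusToMinus (R : Rep.{u, v} K G) (k : Fin n) : R.Plus k →ₗ[K] R.Minus k :=
  (LinearMap.range (R.outMap k)).mkQ ∘ₗ (LinearMap.ker (R.inMap k)).subtype

theorem inMap_outMap (R : Rep.{u, v} K G) {P : Fin n → K[X]} (k : Fin n) {lam : K}
    (hP : R.Satisfies P) (hs : R.IsScalar lam) (x : R.V k) :
    R.inMap k (R.outMap k x) = -((P k).eval lam • x) := by
  have h1 := LinearMap.congr_fun (hP.1 k) x
  have h2 : R.Φ k = algebraMap K (Module.End K (R.V k)) lam := by
    ext y
    simp [hs k y]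
  rw [h2, aeval_algebraMap_apply] at h1
  simp only [LinearMap.add_apply, LinearMap.sum_apply, LinearMap.smul_apply, LinearMap.comp_apply,
    LinearMap.zero_apply, Module.algebraMap_end_apply, coe_aeval_eq_eval] at h1
  rw [← eq_neg_iff_add_eq_zero] at h1
  rw [← h1]
  simp [inMap, outMap]

/-- `φ` is an isomorphism if `Φ = lam` and `P_k(lam) ≠ 0`. -/
theorem plusToMinus_bijective (R : Rep.{u, v} K G) {P : Fin n → K[X]} (k : Fin n) {lam : K}
    (hP : R.Satisfies P) (hs : R.IsScalar lam) (hk : (P k).eval lam ≠ 0) :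
    Function.Bijective (R.plusToMinus k) := by
  constructor
  · rw [injective_iff_map_eq_zero]
    rintro ⟨y, hy⟩ h
    simp only [plusToMinus, LinearMap.comp_apply, Submodule.subtype_apply, Submodule.mkQ_apply,
      Submodule.Quotient.mk_eq_zero, LinearMap.mem_range] at h
    obtain ⟨x, rfl⟩ := h
    rw [LinearMap.mem_ker, R.inMap_outMap k hP hs, neg_eq_zero, smul_eq_zero] at hy
    have hx : x = 0 := hy.resolve_left hk
    simp [hx]
  · intro q
    obtain ⟨y, rfl⟩ := Submodule.mkQ_surjective _ q
    have hz : y + ((P k).eval lam)⁻¹ • R.outMap k (R.inMap k y) ∈ LinearMap.ker (R.inMap k) := by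
      rw [LinearMap.mem_ker, map_add, map_smul, R.inMap_outMap k hP hs, smul_neg, smul_smul,
        inv_mul_cancel₀ hk, one_smul, add_neg_cancel]
    refine ⟨⟨_, hz⟩, ?_⟩
    simp only [plusToMinus, LinearMap.comp_apply, Submodule.subtype_apply, Submodule.mkQ_apply]
    rw [Submodule.Quotient.eq]
    refine ⟨((P k).eval lam)⁻¹ • R.inMap k y, ?_⟩
    simp

/-- The space `F_k(V)(i)`: it is `F⁺_k(V)(k)` if `i = k`, and `V(i)` otherwise. -/
def ReflSpace (R : Rep.{u, v} K G) (k i : Fin n) : Decidable (i = k) → Type v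
  | isTrue _ => R.Plus k
  | isFalse _ => R.V i

instance (R : Rep.{u, v} K G) (k i : Fin n) (d : Decidable (i = k)) :
    AddCommGroup (R.ReflSpace k i d) :=
  match d with
  | isTrue _ => inferInstanceAs (AddCommGroup (R.Plus k))
  | isFalse _ => inferInstanceAs (AddCommGroup (R.V i))

instance (R : Rep.{u, v} K G) (k i : Fin n) (d : Decidable (i = k)) :
    Module K (R.ReflSpace k i d) :=
  match d with
  | isTrue _ => inferInstanceAs (Module K (R.Plus k))
  | isFalse _ => inferInstanceAs (Module K (R.V i))

/-- `Q'_{ik} : F_k(V)(k) → V(i)`, `(x_j) ↦ - s_{ki} xᵢ`. -/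
def reflOut (R : Rep.{u, v} K G) (k : Fin n) (i : {i // G.Adj k i}) : R.Plus k →ₗ[K] R.V i :=
  -(sgn K G k i) • (LinearMap.proj i ∘ₗ (LinearMap.ker (R.inMap k)).subtype)

/-- `Q'_{ki} : V(i) → F_k(V)(k)`: the map `V(i) → ⨁ V(j) → F⁻_k(V)(k)`, followed by `c φ⁻¹`. -/
noncomputable def reflIn (R : Rep.{u, v} K G) (k : Fin n) (c : K)
    (hφ : Function.Bijective (R.plusToMinus k)) (i : {i // G.Adj k i}) : R.V i →ₗ[K] R.Plus k :=
  c • ((LinearEquiv.ofBijective (R.plusToMinus k) hφ).symm.toLinearMap ∘ₗ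
    (LinearMap.range (R.outMap k)).mkQ ∘ₗ LinearMap.single K (fun j : {i // G.Adj k i} => R.V j) i)

/-- The maps `Q'_{ij}` of `F_k(V)`; those between vertices other than `k` are unchanged. -/
noncomputable def reflQ (R : Rep.{u, v} K G) (k : Fin n) (c : K)
    (hφ : Function.Bijective (R.plusToMinus k)) (i j : Fin n) (hij : G.Adj i j) :
    ∀ (di : Decidable (i = k)) (dj : Decidable (j = k)),
      R.ReflSpace k j dj →ₗ[K] R.ReflSpace k i di
  | isTrue hi, isTrue hj => absurd (hi.trans hj.symm) hij.ne
  | isTrue hi, isFalse _ => R.reflIn k c hφ ⟨j, hi ▸ hij⟩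
  | isFalse _, isTrue hj => R.reflOut k ⟨i, hj ▸ hij.symm⟩
  | isFalse _, isFalse _ => R.Q i j hij

/-- The reflected representation `F_k(V)`, for a representation `V` of the quiver with relations given
by `P` on which `Φ = lam`, under the condition `P_k(lam) ≠ 0`. -/
noncomputable def reflect (R : Rep.{u, v} K G) (P : Fin n → K[X]) (k : Fin n) (lam : K)
    (hP : R.Satisfies P) (hs : R.IsScalar lam) (hk : (P k).eval lam ≠ 0) : Rep.{u, v} K G where
  V i := R.ReflSpace k i (instDecidableEqFin n i k)
  Φ _ := lam • LinearMap.id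
  Q i j hij := R.reflQ k ((P k).eval lam) (R.plusToMinus_bijective k hP hs hk) i j hij _ _

/-- `IsIteratedReflection lam β [β₁, …, β_m] P V` says that `V ≅ F_{β₁} ⋯ F_{β_m} (L)`, where `L` is a
simple representation concentrated at the vertex `β`, where every `Φ` acts as `lam`, and where every
functor is applied to a simple representation that satisfies the condition for it to be defined. Each
reflection functor `F_k` goes from the relations given by `σ_k(P)` to those given by
`σ_k(σ_k(P)) = P`. -/
def IsIteratedReflection (lam : K) (β : Fin n) :
    List (Fin n) → (Fin n → K[X]) → Rep.{u, v} K G → Prop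
  | [], P, V => V.Satisfies P ∧ V.IsScalar lam ∧ V.IsSimple ∧ V.IsConcentratedAt β
  | k :: w, P, V =>
      ∃ W : Rep.{u, v} K G, IsIteratedReflection lam β w (weylAct (simpleReflection G k) P) W ∧
        W.IsSimple ∧ ¬ W.IsConcentratedAt k ∧
        ∃ (hW : W.Satisfies (weylAct (simpleReflection G k) P)) (hs : W.IsScalar lam)
          (hk : (weylAct (simpleReflection G k) P k).eval lam ≠ 0),
          V.IsIsomorphic (W.reflect (weylAct (simpleReflection G k) P) k lam hW hs hk)

variable (G) in
/-- Finite representation type of the quiver with the relations given by `P`: there are only finitely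
many isomorphism classes of finite-dimensional indecomposable representations. -/
def FiniteRepresentationType (P : Fin n → K[X]) : Prop :=
  ∃ (N : ℕ) (S : Fin N → Rep.{u, v} K G), ∀ R : Rep.{u, v} K G,
    R.FinDim → R.Satisfies P → R.IsIndecomposable → ∃ a, R.IsIsomorphic (S a)

end Relations

end Rep

end NOneQuiver

/-! Taking traces in the relations and summing over the vertices kills all terms in the maps Q,
because tr(AB) = tr(BA) and the signs are antisymmetric. Hence, if λ is the only eigenvalue of the
Φ_i on V, then λ is a root of ∑ dim V(i) P_i (`IsPrimary.isRoot_comb`). If moreover P_k(λ) = 0,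
genericity makes dim V proportional to e_k, so V lives at k alone. If P_k(λ) ≠ 0, the identity h g =
-P_k(Φ_k) makes g injective and h surjective, and V can be reflected at k, with dimension vector
σ_k(dim V).

Positivity of the Cartan matrix provides, for every nonzero d ≥ 0, a vertex k with (d, e_k) > 0,
where σ_k lowers the total dimension. Induction on the total dimension therefore brings V to a
representation concentrated at one vertex. Reflecting back expresses a simple V as an iterated
reflection and dim V as an image of a simple root.

For finite type the same induction is run on indecomposable representations, whose Φ_i need not be
scalar. For this the reflection is extended to `reflectGen`, using P_k(Φ) + g h in place of P_k(λ)
φ⁻¹. At the end of the descent the root λ of P_k is simple, which forces Φ = λ and dimension one. So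
an indecomposable is determined by (dim V, λ), its dimension vector is one of finitely many roots,
and λ is a root of a nonzero polynomial w(P)_j (`dimVec_mem_orbit_and_isIsomorphic`,
`finiteRepresentationType`). -/

namespace ADEDiagram

/-! ### Positivity of the Cartan matrices of types A, D, E -/

/-- The coefficients of the sum of the positive roots of `E₈`. -/
def e8Weight : ℕ → ℤ
  | 0 => 92
  | 1 => 182
  | 2 => 270
  | 3 => 220
  | 4 => 168
  | 5 => 114
  | _ => 58

/-- A positive vector on which the Cartan matrix is positive. -/
def weight (Γ : ADEDiagram) (i : ℕ) : ℤ :=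
  match Γ with
  -- These are the coefficients of the sum of the positive roots, doubled in type D so that n(n-1)/2
  -- needs no division. Types E₆ and E₇ reuse the values for E₈: cutting the end of the long arm
  -- only removes neighbours, so the inequality survives.
  | A n _ => (i + 1) * (n - i)
  | D n _ => if i + 2 < n then 2 * (i + 1) * (2 * n - 2 - i) else n * (n - 1)
  | E n _ _ => if i + 1 < n then e8Weight i else 136

theorem weight_pos (Γ : ADEDiagram) (i : Fin Γ.rank) : 0 < Γ.weight i := by
  obtain ⟨i, hi⟩ := i
  cases Γ with
  | A n hn =>
    simp only [rank] at hi
    have : (i : ℤ) < n := by exact_mod_cast hi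
    exact mul_pos (by positivity) (by linarith)
  | D n hn =>
    simp only [rank] at hi
    have h1 : (i : ℤ) < n := by exact_mod_cast hi
    have h2 : (4 : ℤ) ≤ n := by exact_mod_cast hn
    simp only [weight]
    split_ifs
    · exact mul_pos (by positivity) (by linarith)
    · exact mul_pos (by linarith) (by linarith)
  | E n hn hn' =>
    simp only [weight, e8Weight]
    split_ifs
    · split <;> norm_num
    · norm_num

theorem sum_adj_weight_lt (Γ : ADEDiagram) (k : Fin Γ.rank) :
    ∑ l : {i // Γ.graph.Adj k i}, Γ.weight (l : Fin Γ.rank) < 2 * Γ.weight k := by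
  have key : ∑ l : {i // Γ.graph.Adj k i}, Γ.weight (l : Fin Γ.rank) =
      ∑ l ∈ Finset.range Γ.rank, if Γ.edge k l ∨ Γ.edge l k then Γ.weight l else 0 := by
    rw [← Fin.sum_univ_eq_sum_range
      (fun l => if Γ.edge k l ∨ Γ.edge l k then Γ.weight l else 0), ← Finset.sum_filter]
    exact (Finset.sum_subtype (p := fun i => Γ.graph.Adj k i) _
      (fun i => by simp only [Finset.mem_filter, Finset.mem_univ, true_and]; rfl)
      (fun i : Fin Γ.rank => Γ.weight i)).symm
  rw [key]
  clear key
  obtain ⟨k, hk⟩ := k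
  cases Γ with
  | A n hn =>
    simp only [rank] at hk
    have h1 : (k : ℤ) < n := by exact_mod_cast hk
    simp only [rank, edge, weight]
    calc _ ≤ ∑ l ∈ Finset.range n, ((if k + 1 = l then ((l : ℤ) + 1) * (n - l) else 0) +
          if l + 1 = k then ((l : ℤ) + 1) * (n - l) else 0) := by
          refine Finset.sum_le_sum fun l hl => ?_
          have : (l : ℤ) < n := by exact_mod_cast Finset.mem_range.1 hl
          have : 0 ≤ ((l : ℤ) + 1) * (n - l) := mul_nonneg (by positivity) (by linarith)
          split_ifs <;> omega
      -- The weight formula vanishes at the positions -1 and n, so the missing neighbours of the two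
      -- ends need no correction. The right side is exactly 2 less than twice the weight at k.
      _ ≤ (k + 2 : ℤ) * (n - k - 1) + k * (n - k + 1) := by
          rw [Finset.sum_add_distrib]
          refine add_le_add ?_ ?_
          · rw [Finset.sum_ite_eq]
            split_ifs
            · push_cast; apply le_of_eq; ring
            · exact mul_nonneg (by positivity) (by linarith)
          · obtain _ | k := k
            · simp
            · simp only [Nat.add_right_cancel_iff, Finset.sum_ite_eq']
              split_ifs
              · push_cast; apply le_of_eq; ring
              · push_cast at h1 ⊢
                exact mul_nonneg (by positivity) (by linarith)
      _ < _ := by nlinarith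
  | D n hn =>
    obtain ⟨m, rfl⟩ := Nat.exists_eq_add_of_le' hn
    simp only [rank] at hk
    have hw : ∀ l ∈ Finset.range (m + 4), 0 ≤ (D (m + 4) hn).weight l := fun l hl =>
      ((D (m + 4) hn).weight_pos ⟨l, Finset.mem_range.1 hl⟩).le
    simp only [rank]
    rw [← Finset.sum_filter]
    have bound : ∀ s ⊆ Finset.range (m + 4), (∀ l, (D (m + 4) hn).edge k l ∨
        (D (m + 4) hn).edge l k → l ∈ s) →
        ∑ s ∈ Finset.range (m + 4) with (D (m + 4) hn).edge k s ∨ (D (m + 4) hn).edge s k,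
          (D (m + 4) hn).weight s ≤ ∑ l ∈ s, (D (m + 4) hn).weight l := fun s hs h =>
      Finset.sum_le_sum_of_subset_of_nonneg (fun l hl => h l (Finset.mem_filter.1 hl).2)
        fun l hl _ => hw l (hs hl)
    simp only [edge] at bound ⊢
    -- The two leaves at the fork, the branch vertex, the far end of the chain, and the interior of
    -- the long arm.
    have hk' : k = m + 3 ∨ k = m + 2 ∨ k = m + 1 ∨ k = 0 ∧ 0 < m + 1 ∨
        ∃ a, k = a + 1 ∧ a + 1 < m + 1 := by
      rcases k with _ | a
      · omega
      · simp only [Nat.add_right_cancel_iff, exists_eq_left']; grind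
    rcases hk' with rfl | rfl | rfl | ⟨rfl, h⟩ | ⟨a, rfl, h⟩
    · refine (bound {m + 1} (by intro; simp; omega) (by intro; simp; omega)).trans_lt ?_
      simp only [Finset.sum_singleton, weight]
      simp
      nlinarith
    · refine (bound {m + 1} (by intro; simp; omega) (by intro; simp; omega)).trans_lt ?_
      simp only [Finset.sum_singleton, weight]
      simp
      nlinarith
    · refine (bound {m, m + 2, m + 3} (by intro; simp; omega)
        (by intro; simp; omega)).trans_lt ?_
      rw [Finset.sum_insert (by simp), Finset.sum_pair (by simp)]
      simp only [weight]
      simp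
      nlinarith
    · refine (bound {1} (by intro; simp; omega) (by intro; simp; omega)).trans_lt ?_
      simp only [Finset.sum_singleton, weight]
      rw [if_pos (by omega)]
      split_ifs <;> push_cast <;> nlinarith
    · refine (bound {a, a + 2} (by intro; simp; omega) (by intro; simp; omega)).trans_lt ?_
      rw [Finset.sum_pair (by simp)]
      simp only [weight]
      rw [if_pos (by omega), if_pos (by omega), if_pos (by omega)]
      push_cast
      nlinarith
  | E n hn hn' =>
    simp only [rank] at hk
    revert k
    have : n = 6 ∨ n = 7 ∨ n = 8 := by omega
    rcases this with rfl | rfl | rfl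
    all_goals simp only [rank, edge, weight]; decide +revert

end ADEDiagram

/-! ### The root lattice, finiteness of the roots, and genericity under the Weyl group -/

namespace NOneQuiver

variable {n : ℕ}

section Roots

variable (G : SimpleGraph (Fin n)) [DecidableRel G.Adj]

/-- The pairing of `d` with the simple root at `k`. -/
def cartan (d : Fin n → ℤ) (k : Fin n) : ℤ := 2 * d k - ∑ l : {i // G.Adj k i}, d l

/-- The symmetric bilinear form of the root lattice. -/
def rootForm (a b : Fin n → ℤ) : ℤ := ∑ k, a k * cartan G b k

theorem sum_subtype_adj {M : Type*} [AddCommMonoid M] (k : Fin n) (f : Fin n → M) :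
    ∑ l : {i // G.Adj k i}, f l = ∑ l, if G.Adj k l then f l else 0 := by
  rw [← Finset.sum_filter]
  exact (Finset.sum_subtype (p := fun i => G.Adj k i) _ (by simp) f).symm

theorem simpleReflection_apply_self (k : Fin n) (d : Fin n → ℤ) :
    simpleReflection G k d k = -d k + ∑ l : {i // G.Adj k i}, d l := by
  simp [simpleReflection, simpleReflectionMap]

theorem simpleReflection_apply_of_ne {k i : Fin n} (h : i ≠ k) (d : Fin n → ℤ) :
    simpleReflection G k d i = d i := by
  simp [simpleReflection, simpleReflectionMap, h]

theorem simpleReflection_apply_simpleReflection (k : Fin n) (d : Fin n → ℤ) :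
    simpleReflection G k (simpleReflection G k d) = d :=
  simpleReflectionMap_involutive G k d

theorem simpleReflection_eq_sub (k : Fin n) (d : Fin n → ℤ) :
    simpleReflection G k d = d - cartan G d k • simpleRoot k := by
  funext i
  by_cases h : i = k
  · subst h
    simp [simpleReflection_apply_self, cartan, simpleRoot]
    ring
  · simp [simpleReflection_apply_of_ne G h, simpleRoot, h]

theorem simpleReflection_mem_weylGroup (k : Fin n) : simpleReflection G k ∈ weylGroup G :=
  Subgroup.subset_closure ⟨k, rfl⟩

variable {G}

theorem rootForm_comm (a b : Fin n → ℤ) : rootForm G a b = rootForm G b a := by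
  simp only [rootForm, cartan, sum_subtype_adj, mul_sub, Finset.sum_sub_distrib, Finset.mul_sum,
    mul_ite, mul_zero]
  congr 1
  · exact Finset.sum_congr rfl fun _ _ => by ring
  · rw [Finset.sum_comm]
    simp only [G.adj_comm, mul_comm]

theorem rootForm_simpleRoot_left (k : Fin n) (d : Fin n → ℤ) :
    rootForm G (simpleRoot k) d = cartan G d k := by
  simp [rootForm, simpleRoot, Pi.single_apply]

theorem cartan_sub_smul (a b : Fin n → ℤ) (c : ℤ) (k : Fin n) :
    cartan G (a - c • b) k = cartan G a k - c * cartan G b k := by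
  simp only [cartan, Pi.sub_apply, Pi.smul_apply, smul_eq_mul, Finset.sum_sub_distrib,
    ← Finset.mul_sum]
  ring

theorem rootForm_sub_smul_right (a b c : Fin n → ℤ) (t : ℤ) :
    rootForm G a (b - t • c) = rootForm G a b - t * rootForm G a c := by
  simp only [rootForm, cartan_sub_smul, mul_sub, Finset.sum_sub_distrib, Finset.mul_sum]
  congr 1
  exact Finset.sum_congr rfl fun _ _ => by ring

theorem cartan_simpleRoot_self (k : Fin n) : cartan G (simpleRoot k) k = 2 := by
  rw [cartan, Finset.sum_eq_zero]
  · simp [simpleRoot]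
  · rintro ⟨l, hl⟩ -
    simp [simpleRoot, hl.ne']

theorem cartan_simpleRoot_of_ne {k i : Fin n} (hi : i ≠ k) :
    cartan G (simpleRoot i) k = -if G.Adj k i then 1 else 0 := by
  rw [cartan, sum_subtype_adj, Finset.sum_eq_single i]
  · simp [simpleRoot, hi.symm]
  · intro b _ hb
    simp [simpleRoot, hb]
  · simp

theorem rootForm_simpleReflection_self (k : Fin n) (d : Fin n → ℤ) :
    rootForm G (simpleReflection G k d) (simpleReflection G k d) = rootForm G d d := by
  rw [simpleReflection_eq_sub, rootForm_sub_smul_right, rootForm_comm _ d,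
    rootForm_comm _ (simpleRoot k), rootForm_sub_smul_right, rootForm_sub_smul_right,
    rootForm_comm d (simpleRoot k), rootForm_simpleRoot_left, rootForm_simpleRoot_left,
    cartan_simpleRoot_self]
  ring

theorem rootForm_weyl_self {w : (Fin n → ℤ) ≃ₗ[ℤ] (Fin n → ℤ)} (hw : w ∈ weylGroup G) :
    ∀ d, rootForm G (w d) (w d) = rootForm G d d := by
  induction hw using Subgroup.closure_induction with
  | mem x hx =>
    obtain ⟨k, rfl⟩ := hx
    exact rootForm_simpleReflection_self k
  | one => intro d; rfl
  | mul x y _ _ hx hy => intro d; rw [LinearEquiv.mul_apply, hx, hy]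
  | inv x _ hx => intro d; rw [← hx, ← LinearEquiv.mul_apply, mul_inv_cancel]; rfl

section Weight

variable {x : Fin n → ℤ} (hx : ∀ k, 0 < x k) (hC : ∀ k, ∑ l : {i // G.Adj k i}, x l < 2 * x k)
include hx hC

/-- The form is symmetric, so (x, d) is a sum of the d_k with positive coefficients (x, e_k) and is
positive. It is also the sum of the x_k (d, e_k), so not all (d, e_k) can be nonpositive. -/
theorem exists_cartan_pos {d : Fin n → ℤ} (hd : ∀ i, 0 ≤ d i) (hd0 : d ≠ 0) :
    ∃ k, 0 < cartan G d k := by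
  by_contra! h
  have h1 : rootForm G x d ≤ 0 := Finset.sum_nonpos fun k _ =>
    mul_nonpos_of_nonneg_of_nonpos (hx k).le (h k)
  obtain ⟨k, hk⟩ := Function.ne_iff.1 hd0
  have hk' : 0 < d k := lt_of_le_of_ne (hd k) (Ne.symm hk)
  have h2 : ∀ k, 0 < cartan G x k := fun k => sub_pos.2 (hC k)
  rw [rootForm_comm] at h1
  exact h1.not_gt (Finset.sum_pos' (fun i _ => mul_nonneg (hd i) (h2 i).le)
    ⟨k, Finset.mem_univ k, mul_pos hk' (h2 k)⟩)

/-- A quantitative form of positive definiteness: in fact ∑ d_k² / x_k ≤ (d, d). The cross terms are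
absorbed edge by edge, using 2 d_k d_l ≤ x_l d_k² / x_k + x_k d_l² / x_l. -/
theorem sq_le_mul_rootForm (d : Fin n → ℤ) (k : Fin n) : d k ^ 2 ≤ x k * rootForm G d d := by
  have hxq : ∀ k, (0 : ℚ) < x k := fun k => by exact_mod_cast hx k
  -- Integrality turns the strict inequality into a gap of 1, which is what leaves ∑ d_k² / x_k on
  -- the other side.
  have h1 : ∀ k, ∑ l, (if G.Adj k l then (x l : ℚ) else 0) ≤ 2 * x k - 1 := fun k => by
    have := hC k
    rw [sum_subtype_adj] at this
    have h' := Int.le_sub_one_of_lt this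
    exact_mod_cast h'
  have hs : ∑ k, ∑ l, (if G.Adj k l then (x l : ℚ) else 0) * (d k ^ 2 / x k) =
      ∑ k, ∑ l, (if G.Adj k l then (x k : ℚ) else 0) * (d l ^ 2 / x l) := by
    rw [Finset.sum_comm]
    simp only [G.adj_comm]
  have hform : (rootForm G d d : ℚ) =
      ∑ k, (2 * (d k : ℚ) ^ 2 - ∑ l, if G.Adj k l then (d k * d l : ℚ) else 0) := by
    simp only [rootForm, cartan, sum_subtype_adj]
    push_cast
    refine Finset.sum_congr rfl fun k _ => ?_
    rw [mul_sub, Finset.mul_sum]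
    simp only [mul_ite, mul_zero]
    ring
  have hq : ∑ k, (d k : ℚ) ^ 2 / x k ≤ rootForm G d d := by
    have h2 : ∑ k, ∑ l, (if G.Adj k l then (d k * d l : ℚ) else 0) ≤
        ∑ k, ∑ l, (if G.Adj k l then (x l : ℚ) else 0) * (d k ^ 2 / x k) := by
      have : 2 * ∑ k, ∑ l, (if G.Adj k l then (d k * d l : ℚ) else 0) ≤
          ∑ k, ∑ l, (if G.Adj k l then (x l : ℚ) else 0) * (d k ^ 2 / x k) +
          ∑ k, ∑ l, (if G.Adj k l then (x k : ℚ) else 0) * (d l ^ 2 / x l) := by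
        rw [Finset.mul_sum, ← Finset.sum_add_distrib]
        refine Finset.sum_le_sum fun k _ => ?_
        rw [Finset.mul_sum, ← Finset.sum_add_distrib]
        refine Finset.sum_le_sum fun l _ => ?_
        split_ifs
        · have hk := hxq k
          have hl := hxq l
          rw [← sub_nonneg]
          have : (x l : ℚ) * (d k ^ 2 / x k) + x k * (d l ^ 2 / x l) - 2 * (d k * d l) =
              (x l * d k - x k * d l) ^ 2 / (x k * x l) := by
            field_simp
            ring
          rw [this]
          positivity
        · simp
      rw [← hs] at this
      linarith
    have h3 : ∑ k, ∑ l, (if G.Adj k l then (x l : ℚ) else 0) * (d k ^ 2 / x k) ≤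
        ∑ k, (2 * x k - 1) * ((d k : ℚ) ^ 2 / x k) := by
      refine Finset.sum_le_sum fun k _ => ?_
      rw [← Finset.sum_mul]
      exact mul_le_mul_of_nonneg_right (h1 k) (div_nonneg (sq_nonneg _) (hxq k).le)
    rw [hform, Finset.sum_sub_distrib]
    have h4 : ∑ k, (2 * x k - 1) * ((d k : ℚ) ^ 2 / x k) =
        ∑ k, 2 * (d k : ℚ) ^ 2 - ∑ k, (d k : ℚ) ^ 2 / x k := by
      rw [← Finset.sum_sub_distrib]
      refine Finset.sum_congr rfl fun k _ => ?_
      have := (hxq k).ne'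
      field_simp
    linarith
  have h5 : (d k : ℚ) ^ 2 / x k ≤ rootForm G d d :=
    (Finset.single_le_sum (f := fun k => (d k : ℚ) ^ 2 / x k)
      (fun i _ => div_nonneg (sq_nonneg _) (hxq i).le) (Finset.mem_univ k)).trans hq
  rw [div_le_iff₀ (hxq k), mul_comm] at h5
  exact_mod_cast h5

/-- The Weyl group preserves the form and simple roots have norm 2, so every root satisfies d_k² ≤ 2
x_k. -/
theorem finite_roots : {d : Fin n → ℤ | ∃ w ∈ weylGroup G, ∃ j, d = w (simpleRoot j)}.Finite := by
  refine (Set.Finite.pi' fun k => Set.finite_Icc (-(2 * x k)) (2 * x k)).subset ?_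
  rintro _ ⟨w, hw, j, rfl⟩ k
  have h := sq_le_mul_rootForm hx hC (w (simpleRoot j)) k
  rw [rootForm_weyl_self hw, rootForm_simpleRoot_left, cartan_simpleRoot_self] at h
  have := hx k
  constructor <;> nlinarith

end Weight

variable {K : Type u} [Field K]

theorem comb_simpleRoot (P : Fin n → K[X]) (k : Fin n) : comb P (simpleRoot k) = P k := by
  simp [comb, simpleRoot, Pi.single_apply, ite_smul]

theorem comb_weylAct (w : (Fin n → ℤ) ≃ₗ[ℤ] (Fin n → ℤ)) (P : Fin n → K[X]) (m : Fin n → ℤ) :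
    comb (weylAct w P) m = comb P (w m) := by
  have hm : w m = ∑ j, m j • w (simpleRoot j) := by
    conv_lhs => rw [pi_eq_sum_univ' m, map_sum]
    refine Finset.sum_congr rfl fun j _ => ?_
    rw [map_smul]
    congr 2
  simp only [comb, weylAct, hm, Finset.sum_apply, Pi.smul_apply, Finset.sum_smul,
    Finset.smul_sum, smul_smul, smul_eq_mul]
  rw [Finset.sum_comm]

theorem Generic.weylAct {P : Fin n → K[X]} (hP : Generic P)
    (w : (Fin n → ℤ) ≃ₗ[ℤ] (Fin n → ℤ)) : Generic (weylAct w P) := by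
  rintro m m' hm hm' ⟨x, hx, hx'⟩
  rw [comb_weylAct] at hx hx'
  obtain ⟨c, hc⟩ := hP (w m) (w m') (by simpa using hm) (by simpa using hm') ⟨x, hx, hx'⟩
  refine ⟨c, fun i => ?_⟩
  -- The map w is only ℤ-linear, so denominators are cleared before it is cancelled.
  have h1 : (c.den : ℤ) • w m' = c.num • w m := by
    funext j
    have : (c.den : ℚ) * w m' j = c.num * w m j := by
      rw [hc, ← mul_assoc, mul_comm (c.den : ℚ), Rat.mul_den_eq_num]
    exact_mod_cast this
  rw [← map_smul, ← map_smul, w.injective.eq_iff] at h1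
  have h2 : ((c.den : ℤ) : ℚ) * m' i = c.num * m i := by exact_mod_cast congrFun h1 i
  have hd : (c.den : ℚ) ≠ 0 := by exact_mod_cast c.den_nz
  apply mul_left_cancel₀ hd
  rw [← mul_assoc, mul_comm (c.den : ℚ) c, Rat.mul_den_eq_num]
  exact_mod_cast h2

theorem weylPolynomials_weylAct_subset {w : (Fin n → ℤ) ≃ₗ[ℤ] (Fin n → ℤ)} (hw : w ∈ weylGroup G)
    (P : Fin n → K[X]) : weylPolynomials G (weylAct w P) ⊆ weylPolynomials G P := by
  rintro _ ⟨v, hv, j, rfl⟩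
  exact ⟨w * v, mul_mem hw hv, j, comb_weylAct w P _⟩

theorem mem_weylPolynomials (P : Fin n → K[X]) (k : Fin n) : P k ∈ weylPolynomials G P :=
  ⟨1, one_mem _, k, (comb_simpleRoot P k).symm⟩

variable (G)

theorem weylAct_simpleReflection_self (P : Fin n → K[X]) (k : Fin n) :
    weylAct (simpleReflection G k) P k = -P k := by
  have h : simpleReflection G k (simpleRoot k) = -simpleRoot k := by
    rw [simpleReflection_eq_sub, cartan_simpleRoot_self]
    module
  rw [weylAct, h, ← comb_simpleRoot P k]
  simp [comb]

theorem weylAct_simpleReflection_of_adj (P : Fin n → K[X]) {k i : Fin n} (hi : G.Adj k i) :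
    weylAct (simpleReflection G k) P i = P i + P k := by
  have h : simpleReflection G k (simpleRoot i) = simpleRoot i + simpleRoot k := by
    rw [simpleReflection_eq_sub, cartan_simpleRoot_of_ne hi.ne', if_pos hi]
    module
  rw [weylAct, h, ← comb_simpleRoot P k, ← comb_simpleRoot P i]
  simp only [comb, Pi.add_apply, add_smul, Finset.sum_add_distrib]

theorem weylAct_simpleReflection_of_not_adj (P : Fin n → K[X]) {k i : Fin n} (hi : ¬G.Adj k i)
    (hne : i ≠ k) : weylAct (simpleReflection G k) P i = P i := by
  have h : simpleReflection G k (simpleRoot i) = simpleRoot i := by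
    rw [simpleReflection_eq_sub, cartan_simpleRoot_of_ne hne, if_neg hi]
    module
  rw [weylAct, h, comb_simpleRoot]

theorem weylAct_simpleReflection_involutive (P : Fin n → K[X]) (k : Fin n) :
    weylAct (simpleReflection G k) (weylAct (simpleReflection G k) P) = P := by
  funext j
  rw [weylAct, comb_weylAct, simpleReflection_apply_simpleReflection, comb_simpleRoot]

end Roots

end NOneQuiver

/-! ### Reflection as a symmetric relation between representations -/

namespace NOneQuiver

variable {n : ℕ}

theorem map_aeval_apply {K V W : Type*} [Field K] [AddCommGroup V] [Module K V] [AddCommGroup W]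
    [Module K W] {Φ : V →ₗ[K] V} {Ψ : W →ₗ[K] W} {f : V →ₗ[K] W}
    (h : ∀ x, f (Φ x) = Ψ (f x)) (p : K[X]) (x : V) :
    f (aeval Φ p x) = aeval Ψ p (f x) := by
  induction p using Polynomial.induction_on' with
  | add p q hp hq => simp [hp, hq]
  | monomial m a =>
    have : ∀ m : ℕ, f ((Φ ^ m) x) = (Ψ ^ m) (f x) := fun m => by
      induction m with
      | zero => rfl
      | succ m ih => rw [pow_succ', pow_succ', Module.End.mul_apply, Module.End.mul_apply, h, ih]
    simp [aeval_monomial, this]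

namespace Rep

variable {K : Type u} [Field K] {G : SimpleGraph (Fin n)}

theorem IsIsomorphic.symm {R S : Rep.{u, v} K G} (h : R.IsIsomorphic S) : S.IsIsomorphic R := by
  obtain ⟨e, h1, h2⟩ := h
  refine ⟨fun i => (e i).symm, fun i x => ?_, fun i j hij x => ?_⟩
  · rw [LinearEquiv.symm_apply_eq, h1, LinearEquiv.apply_symm_apply]
  · rw [LinearEquiv.symm_apply_eq, h2, LinearEquiv.apply_symm_apply]

theorem IsIsomorphic.trans {R S T : Rep.{u, v} K G} (h : R.IsIsomorphic S)
    (h' : S.IsIsomorphic T) : R.IsIsomorphic T := by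
  obtain ⟨e, h1, h2⟩ := h
  obtain ⟨f, h3, h4⟩ := h'
  refine ⟨fun i => (e i).trans (f i), fun i x => ?_, fun i j hij x => ?_⟩
  · simp [h1, h3]
  · simp [h2, h4]

section Maps

variable (R : Rep.{u, v} K G) (k : Fin n)

@[simp]
theorem outMap_apply (x : R.V k) (i : {i // G.Adj k i}) : R.outMap k x i = R.Q i k i.2.symm x :=
  rfl

/-- The direct sum of the maps `Φ_i` over the neighbours of `k`. -/
def nbrΦ : R.Nbr k →ₗ[K] R.Nbr k :=
  LinearMap.pi fun i => R.Φ i ∘ₗ LinearMap.proj i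

theorem aeval_nbrΦ_apply (p : K[X]) (y : R.Nbr k) (i : {i // G.Adj k i}) :
    aeval (R.nbrΦ k) p y i = aeval (R.Φ i) p (y i) :=
  map_aeval_apply (Φ := R.nbrΦ k) (Ψ := R.Φ i)
    (f := LinearMap.proj (R := K) (φ := fun i : {i // G.Adj k i} => R.V i) i) (fun _ => rfl) p y

end Maps

variable [DecidableRel G.Adj]

theorem sgn_mul_self {i k : Fin n} (h : G.Adj i k) : sgn K G i k * sgn K G i k = 1 := by
  unfold sgn
  split_ifs <;> simp

theorem sgn_symm {i k : Fin n} (h : G.Adj i k) : sgn K G k i = -sgn K G i k := by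
  unfold sgn
  rw [if_pos h, if_pos h.symm]
  have := h.ne
  split_ifs with h1 h2 h2
  · exact absurd h1 h2.asymm
  · simp
  · rfl
  · omega

section Maps

variable (R : Rep.{u, v} K G) (k : Fin n)

theorem inMap_apply (y : R.Nbr k) :
    R.inMap k y = ∑ i : {i // G.Adj k i}, sgn K G i k • R.Q k i i.2 (y i) := by
  simp [inMap]

theorem inMap_single (i : {i // G.Adj k i}) (x : R.V i) :
    R.inMap k (Pi.single i x) = sgn K G i k • R.Q k i i.2 x := by
  rw [inMap_apply, Finset.sum_eq_single i]
  · simp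
  · intro b _ hb
    simp [Pi.single_eq_of_ne hb]
  · simp

variable {R} {P : Fin n → K[X]} (hP : R.Satisfies P)
include hP

theorem Satisfies.map_Q {i j : Fin n} (h : G.Adj i j) (x : R.V j) :
    R.Q i j h (R.Φ j x) = R.Φ i (R.Q i j h x) := LinearMap.congr_fun (hP.2 i j h) x

theorem Satisfies.inMap_nbrΦ (y : R.Nbr k) :
    R.inMap k (R.nbrΦ k y) = R.Φ k (R.inMap k y) := by
  simp only [inMap_apply, map_sum, map_smul]
  exact Finset.sum_congr rfl fun i _ => by rw [← hP.map_Q]; rfl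

theorem Satisfies.outMap_Φ (x : R.V k) :
    R.outMap k (R.Φ k x) = R.nbrΦ k (R.outMap k x) :=
  funext fun i => hP.map_Q i.2.symm x

theorem Satisfies.inMap_outMap (x : R.V k) :
    R.inMap k (R.outMap k x) = -aeval (R.Φ k) (P k) x := by
  have h1 := LinearMap.congr_fun (hP.1 k) x
  simp only [LinearMap.add_apply, LinearMap.sum_apply, LinearMap.smul_apply, LinearMap.comp_apply,
    LinearMap.zero_apply] at h1
  rw [← eq_neg_iff_add_eq_zero] at h1
  rw [← h1, inMap_apply]
  rfl

/-- This and the surjectivity of h below are the two halves of the bijectivity of h g = -P_k(Φ_k).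
-/
theorem Satisfies.outMap_injective (hb : Function.Bijective (aeval (R.Φ k) (P k))) :
    Function.Injective (R.outMap k) := by
  rw [injective_iff_map_eq_zero]
  intro x hx
  have h := hP.inMap_outMap k x
  rw [hx, map_zero, zero_eq_neg] at h
  exact (injective_iff_map_eq_zero _).1 hb.1 x h

theorem Satisfies.inMap_surjective (hb : Function.Bijective (aeval (R.Φ k) (P k))) :
    Function.Surjective (R.inMap k) := by
  intro z
  obtain ⟨x, rfl⟩ := hb.2 z
  refine ⟨-R.outMap k x, ?_⟩
  rw [map_neg, hP.inMap_outMap, neg_neg]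

end Maps

/-- Two representations that agree away from the vertex `k` and on the paths of length two through
`k` are isomorphic if `V(k)` is both generated by and embedded into its neighbours. -/
theorem isIsomorphic_of_paths {R S : Rep.{u, v} K G} {P P' : Fin n → K[X]} (k : Fin n)
    (hR : R.Satisfies P) (hS : S.Satisfies P')
    (hRo : Function.Injective (R.outMap k)) (hSo : Function.Injective (S.outMap k))
    (hRi : Function.Surjective (R.inMap k)) (hSi : Function.Surjective (S.inMap k))
    (e : ∀ i, i ≠ k → R.V i ≃ₗ[K] S.V i)
    (hΦ : ∀ i hi x, e i hi (R.Φ i x) = S.Φ i (e i hi x))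
    (hQ : ∀ i j (h : G.Adj i j) hi hj x, e i hi (R.Q i j h x) = S.Q i j h (e j hj x))
    (hpath : ∀ i j (hi : G.Adj k i) (hj : G.Adj k j) x,
      e j hj.ne' (R.Q j k hj.symm (R.Q k i hi x)) =
        S.Q j k hj.symm (S.Q k i hi (e i hi.ne' x))) :
    R.IsIsomorphic S := by
  let E : R.Nbr k ≃ₗ[K] S.Nbr k :=
    LinearEquiv.piCongrRight fun i : {i // G.Adj k i} => e i i.2.ne'
  have hE : ∀ y (i : {i // G.Adj k i}), E y i = e i i.2.ne' (y i) := fun _ _ => rfl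
  have hcomm : ∀ y, S.outMap k (S.inMap k (E y)) = E (R.outMap k (R.inMap k y)) := by
    intro y
    funext j
    simp only [outMap_apply, inMap_apply, hE, map_sum, map_smul, Finset.sum_apply, Pi.smul_apply]
    exact Finset.sum_congr rfl fun i _ => by rw [hpath i j i.2 j.2]
  -- Since g is injective, ker h = ker (g h), and g h depends only on the paths through k. Since h
  -- is surjective, V(k) is then recovered as the quotient by this kernel.
  have hker : (LinearMap.ker (R.inMap k)).map (E : R.Nbr k →ₗ[K] S.Nbr k) =
      LinearMap.ker (S.inMap k) := by
    ext z
    constructor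
    · rintro ⟨y, hy, rfl⟩
      rw [SetLike.mem_coe, LinearMap.mem_ker] at hy
      rw [LinearMap.mem_ker]
      apply hSo
      rw [LinearEquiv.coe_coe, hcomm, hy]
      simp
    · intro hz
      refine ⟨E.symm z, ?_, by simp⟩
      rw [SetLike.mem_coe, LinearMap.mem_ker]
      apply hRo
      apply E.injective
      rw [← hcomm, LinearEquiv.apply_symm_apply, LinearMap.mem_ker.1 hz]
      simp
  let ek : R.V k ≃ₗ[K] S.V k :=
    (LinearMap.quotKerEquivOfSurjective _ hRi).symm ≪≫ₗ
      Submodule.Quotient.equiv _ _ E hker ≪≫ₗ LinearMap.quotKerEquivOfSurjective _ hSi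
  have hek : ∀ y, ek (R.inMap k y) = S.inMap k (E y) := by
    intro y
    have : (LinearMap.quotKerEquivOfSurjective _ hRi).symm (R.inMap k y) =
        Submodule.Quotient.mk y := by
      rw [LinearEquiv.symm_apply_eq]
      rfl
    simp only [ek, LinearEquiv.trans_apply, this]
    rfl
  have hout : ∀ x, S.outMap k (ek x) = E (R.outMap k x) := by
    intro x
    obtain ⟨y, rfl⟩ := hRi x
    rw [hek, hcomm]
  have hekΦ : ∀ x, ek (R.Φ k x) = S.Φ k (ek x) := by
    intro x
    apply hSo
    rw [hout, hR.outMap_Φ, hS.outMap_Φ, hout]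
    funext i
    exact hΦ i _ _
  have heQ : ∀ i (hi : G.Adj k i) x, ek (R.Q k i hi x) = S.Q k i hi (e i hi.ne' x) := by
    intro i hi x
    apply hSo
    rw [hout]
    funext j
    exact hpath i j hi j.2 x
  have hQe : ∀ i (hi : G.Adj i k) x, e i hi.ne (R.Q i k hi x) = S.Q i k hi (ek x) :=
    fun i hi x => (congrFun (hout x) ⟨i, hi.symm⟩).symm
  let f : ∀ i, R.V i ≃ₗ[K] S.V i := fun i => if h : i = k then h ▸ ek else e i h
  have fk : f k = ek := dif_pos rfl
  have fi : ∀ i (h : i ≠ k), f i = e i h := fun i h => dif_neg h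
  refine ⟨f, fun i x => ?_, fun i j h x => ?_⟩
  · by_cases hi : i = k
    · subst hi
      rw [fk, hekΦ]
    · rw [fi i hi, hΦ]
  · by_cases hi : i = k
    · subst hi
      rw [fk, fi j h.ne', heQ]
    · rw [fi i hi]
      by_cases hj : j = k
      · subst hj
        rw [fk, hQe]
      · rw [fi j hj, hQ]

/-- The data exhibiting `S` as the reflection of `R` at `k`: away from `k` they agree, and the paths
through `k` are related by a formula that involves the polynomial `p` at `k`. -/
structure ReflectionData (p : K[X]) (k : Fin n) (R S : Rep.{u, v} K G) where
  e : ∀ i, i ≠ k → R.V i ≃ₗ[K] S.V i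
  map_Φ : ∀ i hi x, e i hi (R.Φ i x) = S.Φ i (e i hi x)
  map_Q : ∀ i j (h : G.Adj i j) hi hj x, e i hi (R.Q i j h x) = S.Q i j h (e j hj x)
  -- With the arrows from k to j rescaled by s_{jk}, and the arrows into k summed without signs,
  -- `loop` and `path` together say that the composite through k in S is g h + p(Φ) on the
  -- neighbouring spaces of R.
  loop : ∀ i (h : G.Adj k i) x, S.Q i k h.symm (S.Q k i h (e i h.ne' x)) =
    e i h.ne' (R.Q i k h.symm (R.Q k i h x) + sgn K G i k • aeval (R.Φ i) p x)
  path : ∀ i j (hi : G.Adj k i) (hj : G.Adj k j), i ≠ j → ∀ x,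
    S.Q j k hj.symm (S.Q k i hi (e i hi.ne' x)) =
      (sgn K G j k * sgn K G i k) • e j hj.ne' (R.Q j k hj.symm (R.Q k i hi x))

namespace ReflectionData

variable {p : K[X]} {k : Fin n} {R S : Rep.{u, v} K G}

theorem map_aeval (D : ReflectionData p k R S) (i : Fin n) (hi : i ≠ k) (q : K[X]) (x : R.V i) :
    D.e i hi (aeval (R.Φ i) q x) = aeval (S.Φ i) q (D.e i hi x) :=
  map_aeval_apply (f := (D.e i hi : R.V i →ₗ[K] S.V i)) (D.map_Φ i hi) q x

/-- Reflection is a symmetric relation. -/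
def symm (D : ReflectionData p k R S) : ReflectionData (-p) k S R where
  e i hi := (D.e i hi).symm
  map_Φ i hi x := by
    rw [LinearEquiv.symm_apply_eq, D.map_Φ, LinearEquiv.apply_symm_apply]
  map_Q i j h hi hj x := by
    rw [LinearEquiv.symm_apply_eq, D.map_Q i j h hi hj, LinearEquiv.apply_symm_apply]
  loop i h x := by
    rw [LinearEquiv.eq_symm_apply]
    obtain ⟨y, rfl⟩ := (D.e i h.ne').surjective x
    rw [LinearEquiv.symm_apply_apply, D.loop, map_add, map_smul, D.map_aeval]
    simp
  path i j hi hj hij x := by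
    obtain ⟨y, rfl⟩ := (D.e i hi.ne').surjective x
    have h : (sgn K G j k * sgn K G i k) * (sgn K G j k * sgn K G i k) = 1 := by
      rw [mul_mul_mul_comm, sgn_mul_self hj.symm, sgn_mul_self hi.symm, one_mul]
    rw [LinearEquiv.symm_apply_apply, D.path i j hi hj hij, map_smul, smul_smul, h, one_smul,
      LinearEquiv.symm_apply_apply]

/-- If `S` and `S'` are isomorphic reflections of `R` and `R'`, then `R` and `R'` are isomorphic. -/
theorem isIsomorphic {R' S' : Rep.{u, v} K G} {P P' : Fin n → K[X]}
    (D : ReflectionData p k R S) (D' : ReflectionData p k R' S') (h : S.IsIsomorphic S')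
    (hR : R.Satisfies P) (hR' : R'.Satisfies P')
    (hRo : Function.Injective (R.outMap k)) (hSo : Function.Injective (R'.outMap k))
    (hRi : Function.Surjective (R.inMap k)) (hSi : Function.Surjective (R'.inMap k)) :
    R.IsIsomorphic R' := by
  obtain ⟨f, h1, h2⟩ := h
  refine isIsomorphic_of_paths k hR hR' hRo hSo hRi hSi
    (fun i hi => D.e i hi ≪≫ₗ f i ≪≫ₗ (D'.e i hi).symm) ?_ ?_ ?_
  · intro i hi x
    simp only [LinearEquiv.trans_apply]
    rw [LinearEquiv.symm_apply_eq, D'.map_Φ, LinearEquiv.apply_symm_apply, D.map_Φ, h1]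
  · intro i j h hi hj x
    simp only [LinearEquiv.trans_apply]
    rw [LinearEquiv.symm_apply_eq, D'.map_Q i j h hi hj, LinearEquiv.apply_symm_apply,
      D.map_Q i j h hi hj, h2]
  · intro i j hi hj x
    simp only [LinearEquiv.trans_apply]
    rw [LinearEquiv.symm_apply_eq]
    obtain ⟨y, hy⟩ := (D'.e i hi.ne').surjective (f i (D.e i hi.ne' x))
    rw [← hy, LinearEquiv.symm_apply_apply]
    -- On the diagonal the terms in p(Φ) match on both sides and cancel; off the diagonal the common
    -- sign is invertible.
    by_cases hij : i = j
    · subst hij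
      have key := D'.loop i hi y
      have hf : f i (aeval (S.Φ i) p (D.e i hi.ne' x)) = aeval (S'.Φ i) p (f i (D.e i hi.ne' x)) :=
        map_aeval_apply (f := (f i : S.V i →ₗ[K] S'.V i)) (h1 i) p _
      rw [hy, ← h2, ← h2, D.loop, map_add, map_add, map_add, map_smul, map_smul, map_smul,
        D'.map_aeval, hy, D.map_aeval, hf] at key
      exact add_right_cancel key
    · have key := D'.path i j hi hj hij y
      have h0 : sgn K G j k * sgn K G i k ≠ 0 := fun h0 => by
        have h3 := sgn_mul_self (K := K) hj.symm
        have h4 := sgn_mul_self (K := K) hi.symm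
        rcases mul_eq_zero.1 h0 with h5 | h5
        · simp [h5] at h3
        · simp [h5] at h4
      rw [hy, ← h2, ← h2, D.path i j hi hj hij, map_smul] at key
      exact smul_right_injective _ h0 key

end ReflectionData

end Rep

end NOneQuiver

/-! ### Reflection preserves simplicity and indecomposability -/

namespace NOneQuiver

variable {n : ℕ}

namespace Rep

variable {K : Type u} [Field K] {G : SimpleGraph (Fin n)}

theorem aeval_mem {V : Type*} [AddCommGroup V] [Module K V] {Φ : V →ₗ[K] V} {A : Submodule K V}
    (hA : ∀ x ∈ A, Φ x ∈ A) (p : K[X]) {x : V} (hx : x ∈ A) : aeval Φ p x ∈ A := by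
  have h := map_aeval_apply (Φ := Φ.restrict hA) (Ψ := Φ) (f := A.subtype) (fun _ => rfl) p ⟨x, hx⟩
  rw [Submodule.subtype_apply, Submodule.subtype_apply] at h
  rw [← h]
  exact Subtype.property _

variable [DecidableRel G.Adj]

namespace ReflectionData

variable {p : K[X]} {k : Fin n} {R S : Rep.{u, v} K G}

/-- The subspaces of `R` that correspond to a family of subspaces of its reflection `S`. -/
def pullback (D : ReflectionData p k R S) (A : ∀ i, Submodule K (S.V i)) (i : Fin n) :
    Submodule K (R.V i) :=
  -- The first condition is void at k, and away from k the second follows from the first when A is a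
  -- subrepresentation. At k this leaves the vectors that all outgoing arrows send into A.
  (⨅ hi, (A i).comap (D.e i hi : R.V i →ₗ[K] S.V i)) ⊓
    ⨅ j, ⨅ hj : G.Adj j i, ⨅ hjk, (A j).comap ((D.e j hjk : R.V j →ₗ[K] S.V j) ∘ₗ R.Q j i hj)

theorem mem_pullback (D : ReflectionData p k R S) (A : ∀ i, Submodule K (S.V i)) (i : Fin n)
    (x : R.V i) : x ∈ D.pullback A i ↔ (∀ hi, D.e i hi x ∈ A i) ∧
      ∀ j (hj : G.Adj j i) hjk, D.e j hjk (R.Q j i hj x) ∈ A j := by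
  simp [pullback, Submodule.mem_iInf]

theorem mem_pullback_of_ne (D : ReflectionData p k R S) {A : ∀ i, Submodule K (S.V i)}
    (hA : S.IsSubrep A) {i : Fin n} (hi : i ≠ k) (x : R.V i) :
    x ∈ D.pullback A i ↔ D.e i hi x ∈ A i := by
  rw [mem_pullback]
  refine ⟨fun h => h.1 hi, fun h => ⟨fun _ => h, fun j hj hjk => ?_⟩⟩
  rw [D.map_Q j i hj hjk hi]
  exact hA.2 j i hj _ h

/-- The only delicate arrows are those into k. There a path through k in R differs from the one in S
by a sign or by a polynomial in Φ, and both preserve A. -/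
theorem isSubrep_pullback (D : ReflectionData p k R S) {P : Fin n → K[X]} (hR : R.Satisfies P)
    {A : ∀ i, Submodule K (S.V i)} (hA : S.IsSubrep A) : R.IsSubrep (D.pullback A) := by
  refine ⟨fun i x hx => ?_, fun i j h x hx => ?_⟩
  · rw [mem_pullback] at hx ⊢
    refine ⟨fun hi => ?_, fun j hj hjk => ?_⟩
    · rw [D.map_Φ]
      exact hA.1 i _ (hx.1 hi)
    · rw [hR.map_Q, D.map_Φ]
      exact hA.1 j _ (hx.2 j hj hjk)
  · rw [mem_pullback] at hx
    by_cases hi : i = k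
    · subst hi
      rw [mem_pullback]
      refine ⟨fun hi => absurd rfl hi, fun l hl hli => ?_⟩
      have hx' := hx.1 h.ne'
      have hS : S.Q l i hl (S.Q i j h (D.e j h.ne' x)) ∈ A l := hA.2 l i hl _ (hA.2 i j h _ hx')
      by_cases hjl : j = l
      · subst hjl
        rw [D.loop j h x, map_add, map_smul, D.map_aeval] at hS
        exact (Submodule.add_mem_iff_left _
          (Submodule.smul_mem _ _ (aeval_mem (hA.1 j) p hx'))).1 hS
      · rw [D.path j l h hl.symm hjl x] at hS
        have h1 : (sgn K G l i * sgn K G j i) * (sgn K G l i * sgn K G j i) = 1 := by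
          rw [mul_mul_mul_comm, sgn_mul_self hl, sgn_mul_self h.symm, one_mul]
        have h2 := Submodule.smul_mem _ (sgn K G l i * sgn K G j i) hS
        rwa [smul_smul, h1, one_smul] at h2
    · rw [D.mem_pullback_of_ne hA hi]
      exact hx.2 i h hi

theorem eq_bot_of_pullback_eq_bot (D : ReflectionData p k R S)
    (hSo : Function.Injective (S.outMap k)) {A : ∀ i, Submodule K (S.V i)} (hA : S.IsSubrep A)
    (h : ∀ i, D.pullback A i = ⊥) (i : Fin n) : A i = ⊥ := by
  have h1 : ∀ i, i ≠ k → A i = ⊥ := by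
    intro i hi
    rw [eq_bot_iff]
    intro a ha
    obtain ⟨x, rfl⟩ := (D.e i hi).surjective a
    rw [← D.mem_pullback_of_ne hA hi, h, Submodule.mem_bot] at ha
    simp [ha]
  by_cases hi : i = k
  · subst hi
    rw [eq_bot_iff]
    intro a ha
    rw [Submodule.mem_bot]
    apply hSo
    rw [map_zero]
    funext j
    have := hA.2 j i j.2.symm a ha
    rwa [h1 j j.2.ne', Submodule.mem_bot] at this
  · exact h1 i hi

theorem eq_top_of_pullback_eq_top (D : ReflectionData p k R S)
    (hSi : Function.Surjective (S.inMap k)) {A : ∀ i, Submodule K (S.V i)} (hA : S.IsSubrep A)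
    (h : ∀ i, D.pullback A i = ⊤) (i : Fin n) : A i = ⊤ := by
  have h1 : ∀ i, i ≠ k → A i = ⊤ := by
    intro i hi
    rw [eq_top_iff]
    intro a _
    obtain ⟨x, rfl⟩ := (D.e i hi).surjective a
    rw [← D.mem_pullback_of_ne hA hi, h]
    trivial
  by_cases hi : i = k
  · subst hi
    rw [eq_top_iff]
    intro a _
    obtain ⟨y, rfl⟩ := hSi a
    rw [inMap_apply]
    refine Submodule.sum_mem _ fun j _ => Submodule.smul_mem _ _ (hA.2 i j j.2 _ ?_)
    rw [h1 j j.2.ne']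
    trivial
  · exact h1 i hi

theorem isNonzero (D : ReflectionData p k R S) (hRo : Function.Injective (R.outMap k))
    (hR : R.IsNonzero) : S.IsNonzero := by
  by_contra hS
  have hS' : ∀ i, Subsingleton (S.V i) := fun i => by
    rw [← not_nontrivial_iff_subsingleton]
    exact fun h => hS ⟨i, h⟩
  have h1 : ∀ i, i ≠ k → Subsingleton (R.V i) := fun i hi =>
    (D.e i hi).injective.subsingleton
  obtain ⟨i, hi⟩ := hR
  rw [← not_subsingleton_iff_nontrivial] at hi
  apply hi
  by_cases hik : i = k
  · subst hik
    have : ∀ j : {j // G.Adj i j}, Subsingleton (R.V j) := fun j => h1 j j.2.ne'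
    exact hRo.subsingleton
  · exact h1 i hik

theorem isSimple (D : ReflectionData p k R S) {P : Fin n → K[X]} (hP : R.Satisfies P)
    (hRo : Function.Injective (R.outMap k)) (hSo : Function.Injective (S.outMap k))
    (hSi : Function.Surjective (S.inMap k)) (hR : R.IsSimple) : S.IsSimple :=
  ⟨D.isNonzero hRo hR.1, fun _ hA => (hR.2 _ (D.isSubrep_pullback hP hA)).imp
    (D.eq_bot_of_pullback_eq_bot hSo hA) (D.eq_top_of_pullback_eq_top hSi hA)⟩

/-- A decomposition of S pulls back to one of R. At k, injectivity of g makes the pieces disjoint,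
and surjectivity of h makes them span, by splitting a preimage neighbour by neighbour. -/
theorem isIndecomposable (D : ReflectionData p k R S) {P : Fin n → K[X]} (hP : R.Satisfies P)
    (hRo : Function.Injective (R.outMap k)) (hRi : Function.Surjective (R.inMap k))
    (hSo : Function.Injective (S.outMap k)) (hR : R.IsIndecomposable) : S.IsIndecomposable := by
  refine ⟨D.isNonzero hRo hR.1, fun A B hA hB hAB => ?_⟩
  have hA' := D.isSubrep_pullback hP hA
  have hB' := D.isSubrep_pullback hP hB
  refine (hR.2 _ _ hA' hB' fun i => ?_).imp
    (D.eq_bot_of_pullback_eq_bot hSo hA) (D.eq_bot_of_pullback_eq_bot hSo hB)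
  have h1 : ∀ i, i ≠ k → IsCompl (D.pullback A i) (D.pullback B i) := by
    intro i hi
    have hc : ∀ {C}, S.IsSubrep C → D.pullback C i =
        (C i).comap (D.e i hi : R.V i →ₗ[K] S.V i) := fun hC => by
      ext x
      exact D.mem_pullback_of_ne hC hi x
    rw [hc hA, hc hB]
    exact (hAB i).map (Submodule.orderIsoMapComap (D.e i hi)).symm
  by_cases hi : i = k
  · subst hi
    constructor
    · rw [Submodule.disjoint_def]
      intro x hx hx'
      rw [mem_pullback] at hx hx'
      apply hRo
      rw [map_zero]
      funext j
      have := Submodule.disjoint_def.1 (hAB j).disjoint _ (hx.2 j j.2.symm j.2.ne')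
        (hx'.2 j j.2.symm j.2.ne')
      simpa using this
    · rw [codisjoint_iff, eq_top_iff]
      intro x _
      obtain ⟨y, rfl⟩ := hRi x
      have hy : ∀ j : {j // G.Adj i j}, ∃ a ∈ D.pullback A j, ∃ b ∈ D.pullback B j, a + b = y j :=
        fun j => Submodule.mem_sup.1 (by
          rw [(h1 j j.2.ne').sup_eq_top]
          trivial)
      choose a ha b hb hab using hy
      refine Submodule.mem_sup.2 ⟨R.inMap i a, ?_, R.inMap i b, ?_, ?_⟩
      · rw [inMap_apply]
        exact Submodule.sum_mem _ fun j _ => Submodule.smul_mem _ _ (hA'.2 i j j.2 _ (ha j))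
      · rw [inMap_apply]
        exact Submodule.sum_mem _ fun j _ => Submodule.smul_mem _ _ (hB'.2 i j j.2 _ (hb j))
      · rw [← map_add]
        congr 1
        funext j
        exact hab j
  · exact h1 i hi

end ReflectionData

end Rep

end NOneQuiver

/-! ### The reflected representation for arbitrary Φ -/

namespace NOneQuiver

variable {n : ℕ}

namespace Rep

variable {K : Type u} [Field K] {G : SimpleGraph (Fin n)}

theorem nbrΦ_single (R : Rep.{u, v} K G) (k : Fin n) (i : {i // G.Adj k i}) (x : R.V i) :
    R.nbrΦ k (Pi.single i x) = Pi.single i (R.Φ i x) := by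
  funext j
  by_cases h : j = i
  · subst h
    simp [nbrΦ]
  · simp [nbrΦ, Pi.single_eq_of_ne h]

variable [DecidableRel G.Adj] {R : Rep.{u, v} K G} {P : Fin n → K[X]} (hP : R.Satisfies P) (k : Fin n)

/-- The action of the maps `Φ_i` on `ker h`. -/
def plusΦ : R.Plus k →ₗ[K] R.Plus k :=
  (R.nbrΦ k).restrict fun y hy => by
    rw [LinearMap.mem_ker] at hy ⊢
    rw [hP.inMap_nbrΦ, hy, map_zero]

/-- The map `P_k(Φ) + g h` from the sum of the neighbouring spaces onto `ker h`. -/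
noncomputable def plusProj : R.Nbr k →ₗ[K] R.Plus k :=
  -- The image lies in ker h because h g = -P_k(Φ_k) and h commutes with P_k(Φ). No inverse of φ is
  -- needed, so the definition makes sense without any condition on P_k(Φ).
  LinearMap.codRestrict _ (aeval (R.nbrΦ k) (P k) + R.outMap k ∘ₗ R.inMap k) fun y => by
    rw [LinearMap.mem_ker, LinearMap.add_apply, map_add, LinearMap.comp_apply, hP.inMap_outMap,
      map_aeval_apply (hP.inMap_nbrΦ k), add_neg_cancel]

theorem coe_plusProj (y : R.Nbr k) : (plusProj hP k y : R.Nbr k) =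
    aeval (R.nbrΦ k) (P k) y + R.outMap k (R.inMap k y) := rfl

theorem coe_aeval_plusΦ (p : K[X]) (y : R.Plus k) :
    ((aeval (plusΦ hP k) p y : R.Plus k) : R.Nbr k) = aeval (R.nbrΦ k) p (y : R.Nbr k) :=
  map_aeval_apply (Φ := plusΦ hP k) (f := (LinearMap.ker (R.inMap k)).subtype) (fun _ => rfl) p y

theorem plusProj_coe (y : R.Plus k) :
    plusProj hP k (y : R.Nbr k) = aeval (plusΦ hP k) (P k) y := by
  apply Subtype.ext
  rw [coe_plusProj, coe_aeval_plusΦ, LinearMap.mem_ker.1 y.2, map_zero, add_zero]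

theorem plusProj_nbrΦ (y : R.Nbr k) :
    plusProj hP k (R.nbrΦ k y) = plusΦ hP k (plusProj hP k y) := by
  apply Subtype.ext
  change _ = R.nbrΦ k (plusProj hP k y : R.Nbr k)
  rw [coe_plusProj, coe_plusProj, map_add, hP.inMap_nbrΦ, hP.outMap_Φ,
    map_aeval_apply (f := R.nbrΦ k) (fun _ => rfl)]

/-- The maps `Φ_i` of the reflected representation. -/
def reflectGenΦ (i : Fin n) :
    ∀ d : Decidable (i = k), R.ReflSpace k i d →ₗ[K] R.ReflSpace k i d
  | isTrue _ => plusΦ hP k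
  | isFalse _ => R.Φ i

/-- The maps `Q_{ij}` of the reflected representation. -/
noncomputable def reflectGenQ (i j : Fin n) (hij : G.Adj i j) :
    ∀ (di : Decidable (i = k)) (dj : Decidable (j = k)),
      R.ReflSpace k j dj →ₗ[K] R.ReflSpace k i di
  | isTrue hi, isTrue hj => absurd (hi.trans hj.symm) hij.ne
  | isTrue hi, isFalse _ => plusProj hP k ∘ₗ
      LinearMap.single K (fun j : {i // G.Adj k i} => R.V j) ⟨j, hi ▸ hij⟩
  | isFalse _, isTrue hj => R.reflOut k ⟨i, hj ▸ hij.symm⟩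
  | isFalse _, isFalse _ => R.Q i j hij

/-- The reflection of a representation on which the maps `Φ_i` need not be scalars. -/
noncomputable def reflectGen : Rep.{u, v} K G where
  V i := R.ReflSpace k i (instDecidableEqFin n i k)
  Φ i := reflectGenΦ hP k i _
  Q i j hij := reflectGenQ hP k i j hij _ _

/-- A description of a reflected representation up to isomorphism. -/
structure ReflectionModel (S : Rep.{u, v} K G) where
  e : ∀ i, i ≠ k → R.V i ≃ₗ[K] S.V i
  eK : R.Plus k ≃ₗ[K] S.V k
  map_Φ : ∀ i hi x, e i hi (R.Φ i x) = S.Φ i (e i hi x)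
  map_plusΦ : ∀ x, eK (plusΦ hP k x) = S.Φ k (eK x)
  map_Q : ∀ i j (h : G.Adj i j) hi hj x, e i hi (R.Q i j h x) = S.Q i j h (e j hj x)
  map_out : ∀ i (h : G.Adj k i) x,
    S.Q i k h.symm (eK x) = sgn K G i k • e i h.ne' ((x : R.Nbr k) ⟨i, h⟩)
  map_in : ∀ i (h : G.Adj k i) x,
    S.Q k i h (e i h.ne' x) = eK (plusProj hP k (Pi.single ⟨i, h⟩ x))

/-- Away from `k` the spaces are unchanged. -/
def reflSpaceEquivOfNe (R : Rep.{u, v} K G) {i : Fin n} (hi : i ≠ k) :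
    ∀ d : Decidable (i = k), R.V i ≃ₗ[K] R.ReflSpace k i d
  | isTrue h => absurd h hi
  | isFalse _ => LinearEquiv.refl K (R.V i)

/-- At `k` the space is `ker h`. -/
def reflSpaceEquivSelf (R : Rep.{u, v} K G) :
    ∀ d : Decidable (k = k), R.Plus k ≃ₗ[K] R.ReflSpace k k d
  | isTrue _ => LinearEquiv.refl K (R.Plus k)
  | isFalse h => absurd rfl h

theorem reflectGenΦ_equivOfNe {i : Fin n} (hi : i ≠ k) (d : Decidable (i = k)) (x : R.V i) :
    R.reflSpaceEquivOfNe k hi d (R.Φ i x) =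
      reflectGenΦ hP k i d (R.reflSpaceEquivOfNe k hi d x) := by
  cases d with
  | isTrue h => exact absurd h hi
  | isFalse h => rfl

theorem reflectGenΦ_equivSelf (d : Decidable (k = k)) (x : R.Plus k) :
    R.reflSpaceEquivSelf k d (plusΦ hP k x) =
      reflectGenΦ hP k k d (R.reflSpaceEquivSelf k d x) := by
  cases d with
  | isTrue h => rfl
  | isFalse h => exact absurd rfl h

theorem reflectGenQ_equivOfNe {i j : Fin n} (h : G.Adj i j) (hi : i ≠ k) (hj : j ≠ k)
    (di : Decidable (i = k)) (dj : Decidable (j = k)) (x : R.V j) :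
    R.reflSpaceEquivOfNe k hi di (R.Q i j h x) =
      reflectGenQ hP k i j h di dj (R.reflSpaceEquivOfNe k hj dj x) := by
  cases di with
  | isTrue h => exact absurd h hi
  | isFalse h =>
    cases dj with
    | isTrue h => exact absurd h hj
    | isFalse h => rfl

theorem reflectGenQ_equivSelf {i : Fin n} (h : G.Adj k i)
    (di : Decidable (i = k)) (dk : Decidable (k = k)) (x : R.Plus k) :
    reflectGenQ hP k i k h.symm di dk (R.reflSpaceEquivSelf k dk x) =
      sgn K G i k • R.reflSpaceEquivOfNe k h.ne' di ((x : R.Nbr k) ⟨i, h⟩) := by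
  cases di with
  | isTrue hi => exact absurd hi h.ne'
  | isFalse hi =>
    cases dk with
    | isTrue hk =>
      change (-sgn K G k i) • (x : R.Nbr k) ⟨i, h⟩ = _
      -- The sign -s_{ki} in the definition of the functor equals s_{ik}.
      rw [sgn_symm h.symm, neg_neg]
      rfl
    | isFalse hk => exact absurd rfl hk

theorem reflectGenQ_self_equivOfNe {i : Fin n} (h : G.Adj k i)
    (di : Decidable (i = k)) (dk : Decidable (k = k)) (x : R.V i) :
    reflectGenQ hP k k i h dk di (R.reflSpaceEquivOfNe k h.ne' di x) =
      R.reflSpaceEquivSelf k dk (plusProj hP k (Pi.single ⟨i, h⟩ x)) := by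
  cases di with
  | isTrue hi => exact absurd hi h.ne'
  | isFalse hi =>
    cases dk with
    | isTrue hk => rfl
    | isFalse hk => exact absurd rfl hk

/-- The reflected representation has the expected description. -/
noncomputable def reflectGenModel : ReflectionModel hP k (reflectGen hP k) where
  e _ hi := R.reflSpaceEquivOfNe k hi _
  eK := R.reflSpaceEquivSelf k _
  map_Φ _ hi x := reflectGenΦ_equivOfNe hP k hi _ x
  map_plusΦ x := reflectGenΦ_equivSelf hP k _ x
  map_Q _ _ h hi hj x := reflectGenQ_equivOfNe hP k h hi hj _ _ x
  map_out _ h x := reflectGenQ_equivSelf hP k h _ _ x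
  map_in _ h x := reflectGenQ_self_equivOfNe hP k h _ _ x

theorem finDim_reflectGen (hR : R.FinDim) : (reflectGen hP k).FinDim := by
  intro i
  have hR' : ∀ i, FiniteDimensional K (R.V i) := hR
  by_cases hi : i = k
  · subst hi
    exact Module.Finite.equiv (reflectGenModel hP i).eK
  · exact Module.Finite.equiv ((reflectGenModel hP k).e i hi)

theorem dimVec_reflectGen (hR : R.FinDim) (hRi : Function.Surjective (R.inMap k)) :
    (reflectGen hP k).dimVec = simpleReflection G k R.dimVec := by
  have hR' : ∀ i, FiniteDimensional K (R.V i) := hR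
  funext i
  by_cases hi : i = k
  · subst hi
    rw [simpleReflection_apply_self]
    simp only [dimVec]
    rw [← (reflectGenModel hP i).eK.finrank_eq]
    have h := LinearMap.finrank_range_add_finrank_ker (R.inMap i)
    rw [LinearMap.range_eq_top.2 hRi, finrank_top, Module.finrank_pi_fintype] at h
    have h' := congrArg (Nat.cast : ℕ → ℤ) h
    push_cast at h'
    linarith
  · rw [simpleReflection_apply_of_ne G hi]
    simp only [dimVec]
    rw [((reflectGenModel hP k).e i hi).finrank_eq]

namespace ReflectionModel

variable {hP} {k} {S : Rep.{u, v} K G} (M : ReflectionModel hP k S)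
include M

theorem loop (i : Fin n) (h : G.Adj k i) (x : R.V i) :
    S.Q i k h.symm (S.Q k i h (M.e i h.ne' x)) =
      M.e i h.ne' (R.Q i k h.symm (R.Q k i h x) + sgn K G i k • aeval (R.Φ i) (P k) x) := by
  rw [M.map_in, M.map_out i h, coe_plusProj, Pi.add_apply, aeval_nbrΦ_apply, Pi.single_eq_same,
    inMap_single, outMap_apply, map_smul, ← map_smul, smul_add, smul_smul, sgn_mul_self h.symm,
    one_smul, add_comm]

/-- A reflected representation is related to the original one by reflection. -/
def reflectionData : ReflectionData (P k) k R S where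
  e := M.e
  map_Φ := M.map_Φ
  map_Q := M.map_Q
  loop := M.loop
  path i j hi hj hij x := by
    have hne : (⟨j, hj⟩ : {i // G.Adj k i}) ≠ ⟨i, hi⟩ := fun h => hij (congrArg Subtype.val h).symm
    rw [M.map_in, M.map_out, coe_plusProj, Pi.add_apply, aeval_nbrΦ_apply,
      Pi.single_eq_of_ne hne, map_zero, zero_add, inMap_single, outMap_apply, map_smul, map_smul,
      smul_smul]

theorem outMap_injective : Function.Injective (S.outMap k) := by
  rw [injective_iff_map_eq_zero]
  intro x hx
  obtain ⟨y, rfl⟩ := M.eK.surjective x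
  have : y = 0 := by
    apply Subtype.ext
    funext i
    have h := congrFun hx i
    rw [outMap_apply, M.map_out i i.2, Pi.zero_apply, smul_eq_zero] at h
    have h0 : sgn K G i k ≠ 0 := fun h0 => by
      have := sgn_mul_self (K := K) i.2.symm
      simp [h0] at this
    simpa using h.resolve_left h0
  rw [this, map_zero]

/-- At k the new loops add up to P_k(Φ) on ker h, cancelled by the new polynomial -P_k. At a
neighbour j the loop through k changes by s_{kj} s_{jk} P_k(Φ_j) = -P_k(Φ_j), cancelled by the extra
P_k in P_j + P_k. Elsewhere nothing changes. -/
theorem satisfies : S.Satisfies (weylAct (simpleReflection G k) P) := by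
  refine ⟨fun j => ?_, fun i j h => ?_⟩
  · by_cases hj : j = k
    · subst hj
      ext x
      obtain ⟨y, rfl⟩ := M.eK.surjective x
      have h1 : aeval (S.Φ j) (P j) (M.eK y) = M.eK (plusProj hP j y) := by
        rw [plusProj_coe]
        exact (map_aeval_apply (f := (M.eK : R.Plus j →ₗ[K] S.V j)) M.map_plusΦ _ _).symm
      have h2 : ∀ i : {i // G.Adj j i},
          sgn K G i j • S.Q j i i.2 (S.Q i j i.2.symm (M.eK y)) =
            M.eK (plusProj hP j (Pi.single i ((y : R.Nbr j) i))) := fun i => by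
        rw [M.map_out, map_smul, smul_smul, sgn_mul_self i.2.symm, one_smul, M.map_in]
      simp only [LinearMap.add_apply, LinearMap.sum_apply, LinearMap.smul_apply,
        LinearMap.comp_apply, weylAct_simpleReflection_self, map_neg, LinearMap.neg_apply, h1, h2,
        LinearMap.zero_apply]
      rw [← map_sum, ← map_sum, Finset.univ_sum_single, add_neg_cancel]
    · ext x
      obtain ⟨z, rfl⟩ := (M.e j hj).surjective x
      have haev : ∀ q, aeval (S.Φ j) q (M.e j hj z) = M.e j hj (aeval (R.Φ j) q z) := fun q =>
        (M.reflectionData.map_aeval j hj q z).symm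
      have hrel := LinearMap.congr_fun (hP.1 j) z
      have h2 : ∀ i : {i // G.Adj j i},
          sgn K G i j • S.Q j i i.2 (S.Q i j i.2.symm (M.e j hj z)) =
            M.e j hj (sgn K G i j • R.Q j i i.2 (R.Q i j i.2.symm z)) +
              if (i : Fin n) = k then -M.e j hj (aeval (R.Φ j) (P k) z) else 0 := by
        rintro ⟨i, hi⟩
        by_cases hik : i = k
        · subst hik
          have hs : sgn K G i j * sgn K G j i = -1 := by
            rw [sgn_symm hi, neg_mul, sgn_mul_self hi]
          rw [if_pos rfl, M.loop, map_add, map_smul, map_smul, smul_add, smul_smul, hs, neg_smul,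
            one_smul]
        · rw [if_neg hik, ← M.map_Q i j hi.symm hik, ← M.map_Q j i hi, map_smul, add_zero]
      have h3 : ∑ i : {i // G.Adj j i},
          (if (i : Fin n) = k then -M.e j hj (aeval (R.Φ j) (P k) z) else 0) =
          if G.Adj j k then -M.e j hj (aeval (R.Φ j) (P k) z) else 0 := by
        rw [sum_subtype_adj G j (fun i => if i = k then -M.e j hj (aeval (R.Φ j) (P k) z) else 0),
          Finset.sum_eq_single k]
        · simp
        · intro b _ hb
          simp [hb]
        · simp
      simp only [LinearMap.add_apply, LinearMap.sum_apply, LinearMap.smul_apply,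
        LinearMap.comp_apply, h2, Finset.sum_add_distrib, h3, haev, LinearMap.zero_apply] at hrel ⊢
      rw [← map_sum, eq_neg_of_add_eq_zero_left hrel]
      by_cases hjk : G.Adj j k
      · rw [if_pos hjk, weylAct_simpleReflection_of_adj G P hjk.symm, map_add,
          LinearMap.add_apply, map_add, map_neg]
        abel
      · rw [if_neg hjk, weylAct_simpleReflection_of_not_adj G P (fun h => hjk h.symm) hj, map_neg]
        abel
  · ext x
    rw [LinearMap.comp_apply, LinearMap.comp_apply]
    by_cases hi : i = k
    · subst hi
      obtain ⟨z, rfl⟩ := (M.e j h.ne').surjective x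
      rw [← M.map_Φ, M.map_in, M.map_in, ← M.map_plusΦ, ← plusProj_nbrΦ, nbrΦ_single]
    · by_cases hj : j = k
      · subst hj
        obtain ⟨y, rfl⟩ := M.eK.surjective x
        rw [← M.map_plusΦ, M.map_out i h.symm, M.map_out i h.symm, map_smul, ← M.map_Φ]
        rfl
      · obtain ⟨z, rfl⟩ := (M.e j hj).surjective x
        rw [← M.map_Φ, ← M.map_Q i j h hi hj, ← M.map_Q i j h hi hj, ← M.map_Φ, hP.map_Q]

end ReflectionModel

theorem reflectGenΦ_apply_of_isScalar {lam : K} (hs : R.IsScalar lam) (i : Fin n)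
    (d : Decidable (i = k)) (x : R.ReflSpace k i d) : reflectGenΦ hP k i d x = lam • x := by
  cases d with
  | isTrue h => exact Subtype.ext (funext fun j => hs j _)
  | isFalse h => exact hs i x

/-- Modulo the image of g, the map P_k(λ) + g h is multiplication by P_k(λ), so as a map into ker h
it is P_k(λ) φ⁻¹ after the projection to coker g. -/
theorem reflIn_apply_of_isScalar {lam : K} (hs : R.IsScalar lam)
    (hbij : Function.Bijective (R.plusToMinus k)) (i : {i // G.Adj k i}) (x : R.V i) :
    R.reflIn k ((P k).eval lam) hbij i x = plusProj hP k (Pi.single i x) := by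
  have hΦ : ∀ i, R.Φ i = algebraMap K (Module.End K (R.V i)) lam := fun i => by
    ext x
    simp [hs i x]
  have haev : ∀ y : R.Nbr k, aeval (R.nbrΦ k) (P k) y = (P k).eval lam • y := fun y => by
    funext i
    rw [aeval_nbrΦ_apply, hΦ, aeval_algebraMap_apply]
    simp
  simp only [reflIn, LinearMap.smul_apply, LinearMap.comp_apply, LinearEquiv.coe_coe,
    LinearMap.single_apply]
  rw [← map_smul, LinearEquiv.symm_apply_eq, LinearEquiv.ofBijective_apply, ← map_smul]
  simp only [plusToMinus, LinearMap.comp_apply, Submodule.subtype_apply, Submodule.mkQ_apply]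
  rw [Submodule.Quotient.eq, coe_plusProj, haev]
  exact ⟨-R.inMap k (Pi.single i x), by simp⟩

theorem reflectGenQ_eq_reflQ {lam : K} (hs : R.IsScalar lam)
    (hbij : Function.Bijective (R.plusToMinus k)) (i j : Fin n) (h : G.Adj i j)
    (di : Decidable (i = k)) (dj : Decidable (j = k)) (x : R.ReflSpace k j dj) :
    reflectGenQ hP k i j h di dj x = R.reflQ k ((P k).eval lam) hbij i j h di dj x := by
  cases di with
  | isTrue hi =>
    cases dj with
    | isTrue hj => exact absurd (hi.trans hj.symm) h.ne
    | isFalse hj => exact (reflIn_apply_of_isScalar hP k hs hbij ⟨j, hi ▸ h⟩ x).symm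
  | isFalse hi => cases dj <;> rfl

/-- On representations with scalar `Φ` the reflections agree. -/
theorem reflectGen_isIsomorphic_reflect {lam : K} (hs : R.IsScalar lam)
    (hk : (P k).eval lam ≠ 0) :
    (reflectGen hP k).IsIsomorphic (R.reflect P k lam hP hs hk) :=
  ⟨fun i => LinearEquiv.refl K (R.ReflSpace k i (instDecidableEqFin n i k)),
    fun i x => reflectGenΦ_apply_of_isScalar hP k hs i _ x,
    fun i j h x => reflectGenQ_eq_reflQ hP k hs (R.plusToMinus_bijective k hP hs hk) i j h _ _ x⟩

end Rep

end NOneQuiver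

/-! ### Representations with a single eigenvalue: traces and concentration at a vertex -/

namespace NOneQuiver

variable {n : ℕ}

section Primary

variable {K V : Type*} [Field K] [AddCommGroup V] [Module K V] {Φ : V →ₗ[K] V} {lam : K} {m : ℕ}

theorem aeval_bijective_of_eval_ne_zero (h : aeval Φ ((X - C lam) ^ m) = 0) {q : K[X]}
    (hq : q.eval lam ≠ 0) : Function.Bijective (aeval Φ q) := by
  have hc : IsCoprime ((X - C lam) ^ m) q :=
    ((irreducible_X_sub_C lam).coprime_iff_not_dvd.2 fun hd => hq (dvd_iff_isRoot.1 hd)).pow_left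
  obtain ⟨a, b, hab⟩ := hc
  have h1 : aeval Φ b * aeval Φ q = 1 := by
    rw [← map_mul, ← map_one (aeval (R := K) Φ), ← hab, map_add, map_mul _ a, h, mul_zero, zero_add]
  have h2 : aeval Φ q * aeval Φ b = 1 := by rw [← map_mul, mul_comm, map_mul, h1]
  exact Function.bijective_iff_has_inverse.2 ⟨aeval Φ b, LinearMap.congr_fun h1,
    LinearMap.congr_fun h2⟩

/-- The difference q(Φ) - q(λ) is nilpotent, hence of trace zero. -/
theorem trace_aeval_eq (h : aeval Φ ((X - C lam) ^ m) = 0) [FiniteDimensional K V]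
    (q : K[X]) : LinearMap.trace K V (aeval Φ q) = Module.finrank K V * q.eval lam := by
  obtain ⟨r, hr⟩ := X_sub_C_dvd_sub_C_eval (p := q) (a := lam)
  have hnil : IsNilpotent (aeval Φ (q - C (q.eval lam))) := ⟨m, by
    rw [← map_pow, hr, mul_pow, map_mul, h, zero_mul]⟩
  have htr := (LinearMap.isNilpotent_trace_of_isNilpotent hnil).eq_zero
  rw [map_sub, map_sub, sub_eq_zero] at htr
  rw [htr, aeval_C, Algebra.algebraMap_eq_smul_one, map_smul, LinearMap.trace_one, smul_eq_mul,
    mul_comm]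

end Primary

namespace Rep

variable {K : Type u} [Field K] {G : SimpleGraph (Fin n)}

/-- All the maps `Φ_i` have `lam` as their only possible eigenvalue. -/
def IsPrimary (R : Rep.{u, v} K G) (lam : K) : Prop :=
  ∃ m : ℕ, ∀ i, aeval (R.Φ i) ((X - C lam) ^ m) = 0

theorem IsScalar.isPrimary {R : Rep.{u, v} K G} {lam : K} (h : R.IsScalar lam) :
    R.IsPrimary lam :=
  ⟨1, fun i => by ext x; simp [h i x]⟩

theorem IsSimple.isIndecomposable {R : Rep.{u, v} K G} (h : R.IsSimple) : R.IsIndecomposable := by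
  refine ⟨h.1, fun U W hU hW hc => (h.2 U hU).imp_right fun hU' i => ?_⟩
  have := (hc i).inf_eq_bot
  rwa [hU' i, top_inf_eq] at this

theorem IsNonzero.dimVec_ne_zero {R : Rep.{u, v} K G} (h : R.IsNonzero) (hR : R.FinDim) :
    R.dimVec ≠ 0 := by
  obtain ⟨i, hi⟩ := h
  have := hR i
  intro h0
  have h1 : (Module.finrank K (R.V i) : ℤ) = 0 := congrFun h0 i
  exact (Module.finrank_pos (R := K) (M := R.V i)).ne' (by exact_mod_cast h1)

theorem dimVec_nonneg (R : Rep.{u, v} K G) (i : Fin n) : 0 ≤ R.dimVec i := Int.natCast_nonneg _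

theorem aeval_Φ_Q [DecidableRel G.Adj] {R : Rep.{u, v} K G} {P : Fin n → K[X]} (hR : R.Satisfies P)
    {i j : Fin n} (h : G.Adj i j) (q : K[X]) (x : R.V j) :
    R.Q i j h (aeval (R.Φ j) q x) = aeval (R.Φ i) q (R.Q i j h x) :=
  map_aeval_apply (hR.map_Q h) q x

theorem aeval_Φ_comm (R : Rep.{u, v} K G) (i : Fin n) (q : K[X]) (x : R.V i) :
    R.Φ i (aeval (R.Φ i) q x) = aeval (R.Φ i) q (R.Φ i x) :=
  map_aeval_apply (f := R.Φ i) (fun _ => rfl) q x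

theorem IsPrimary.bijective {R : Rep.{u, v} K G} {lam : K} (h : R.IsPrimary lam) {k : Fin n} {q : K[X]}
    (hq : q.eval lam ≠ 0) : Function.Bijective (aeval (R.Φ k) q) :=
  aeval_bijective_of_eval_ne_zero (h.choose_spec k) hq

theorem Q_eq_zero_of_isConcentratedAt {R : Rep.{u, v} K G} {k : Fin n} (h : R.IsConcentratedAt k) {i j : Fin n}
    (hij : G.Adj i j) : R.Q i j hij = 0 := by
  ext x
  by_cases hi : i = k
  · have := h j fun hj => hij.ne (hi.trans hj.symm)
    rw [Subsingleton.elim x 0, map_zero, map_zero]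
  · have := h i hi
    exact Subsingleton.elim _ _

theorem IsConcentratedAt.nontrivial {R : Rep.{u, v} K G} {k : Fin n} (h : R.IsConcentratedAt k) (hR : R.IsNonzero) :
    Nontrivial (R.V k) := by
  obtain ⟨i, hi⟩ := hR
  by_cases hik : i = k
  · exact hik ▸ hi
  · exact absurd (h i hik) (not_subsingleton_iff_nontrivial.2 hi)

theorem IsConcentratedAt.isSubrep {R : Rep.{u, v} K G} {k : Fin n} (h : R.IsConcentratedAt k) {lam : K}
    (hs : R.IsScalar lam) (U : ∀ i, Submodule K (R.V i)) : R.IsSubrep U := by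
  refine ⟨fun i x hx => ?_, fun i j hij x hx => ?_⟩
  · rw [hs]
    exact Submodule.smul_mem _ _ hx
  · rw [Q_eq_zero_of_isConcentratedAt h hij]
    exact Submodule.zero_mem _

theorem IsConcentratedAt.isIsomorphic {R : Rep.{u, v} K G} {k : Fin n} {S : Rep.{u, v} K G}
    (h : R.IsConcentratedAt k) (h' : S.IsConcentratedAt k) {lam : K}
    (hs : R.IsScalar lam) (hs' : S.IsScalar lam) (hf : R.FinDim) (hf' : S.FinDim)
    (hd : R.dimVec = S.dimVec) : R.IsIsomorphic S := by
  have hR : ∀ i, FiniteDimensional K (R.V i) := hf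
  have hS : ∀ i, FiniteDimensional K (S.V i) := hf'
  refine ⟨fun i => LinearEquiv.ofFinrankEq _ _ (Int.ofNat_inj.1 (congrFun hd i)),
    fun i x => ?_, fun i j hij x => ?_⟩
  · rw [hs, hs', map_smul]
  · rw [Q_eq_zero_of_isConcentratedAt h, Q_eq_zero_of_isConcentratedAt h']
    simp

theorem not_isConcentratedAt_of_outMap_injective {R : Rep.{u, v} K G} {k : Fin n} (hR : R.IsNonzero)
    (ho : Function.Injective (R.outMap k)) : ¬R.IsConcentratedAt k := by
  intro h
  have : ∀ i : {i // G.Adj k i}, Subsingleton (R.V i) := fun i => h i i.2.ne'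
  exact not_subsingleton_iff_nontrivial.2 (h.nontrivial hR) ho.subsingleton

/-- All Q vanish and Φ is scalar, so every family of subspaces is a subrepresentation. A line in
V(k) then has a complement, which indecomposability forces to be zero. -/
theorem IsConcentratedAt.dimVec_eq {R : Rep.{u, v} K G} {k : Fin n} (h : R.IsConcentratedAt k) {lam : K}
    (hs : R.IsScalar lam) (hR : R.IsIndecomposable) : R.dimVec = simpleRoot k := by
  have := h.nontrivial hR.1
  obtain ⟨x, hx⟩ := exists_ne (0 : R.V k)
  obtain ⟨W, hW⟩ := Submodule.exists_isCompl (Submodule.span K {x})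
  have hd := hR.2 (Function.update (fun i => (⊥ : Submodule K (R.V i))) k (Submodule.span K {x}))
    (Function.update (fun i => (⊤ : Submodule K (R.V i))) k W)
    (h.isSubrep hs _) (h.isSubrep hs _) fun i => by
      by_cases hi : i = k
      · subst hi
        simpa using hW
      · simpa [hi] using isCompl_bot_top
  funext i
  by_cases hi : i = k
  · subst hi
    rcases hd with hd | hd
    · have := hd i
      simp [hx] at this
    · have := hd i
      rw [Function.update_self] at this
      have htop := hW.sup_eq_top
      rw [this, sup_bot_eq] at htop
      have hfin := finrank_span_singleton (K := K) hx
      rw [htop, finrank_top] at hfin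
      simp [dimVec, simpleRoot, hfin]
  · have := h i hi
    simp [dimVec, simpleRoot, hi, Module.finrank_zero_of_subsingleton]

section Eigenvalue

variable [DecidableRel G.Adj] [IsAlgClosed K] {R : Rep.{u, v} K G} {P : Fin n → K[X]}

/-- The λ-eigenspaces of the Φ_i form a subrepresentation, because the Q intertwine the Φ. -/
theorem IsSimple.exists_isScalar (h : R.IsSimple) (hf : R.FinDim) (hR : R.Satisfies P) :
    ∃ lam, R.IsScalar lam := by
  obtain ⟨⟨i, hi⟩, hs⟩ := h
  have := hf i
  obtain ⟨lam, hlam⟩ := Module.End.exists_eigenvalue (R.Φ i)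
  obtain ⟨x, hx⟩ := hlam.exists_hasEigenvector
  refine ⟨lam, ?_⟩
  have hmem : ∀ i (x : R.V i), x ∈ Module.End.eigenspace (R.Φ i) lam ↔ R.Φ i x = lam • x :=
    fun i x => Module.End.mem_eigenspace_iff
  rcases hs (fun i => Module.End.eigenspace (R.Φ i) lam) ⟨fun i x hx => by
      rw [hmem] at hx ⊢
      rw [hx, map_smul, hx], fun i j h x hx => by
      rw [hmem] at hx ⊢
      rw [← hR.map_Q, hx, map_smul]⟩ with h | h
  · exact absurd h (fun h => hx.2 (by simpa [h i] using hx.1))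
  · intro i x
    rw [← hmem, h i]
    trivial

/-- Fitting decomposition of Φ - λ, performed at all vertices with one common exponent, splits the
representation into two subrepresentations. -/
theorem IsIndecomposable.exists_isPrimary (h : R.IsIndecomposable) (hf : R.FinDim)
    (hR : R.Satisfies P) : ∃ lam, R.IsPrimary lam := by
  obtain ⟨⟨i, hi⟩, hs⟩ := h
  have hf' : ∀ i, FiniteDimensional K (R.V i) := hf
  obtain ⟨lam, hlam⟩ := Module.End.exists_eigenvalue (R.Φ i)
  obtain ⟨x, hx⟩ := hlam.exists_hasEigenvector
  -- The bound m ≥ 1 ensures that the eigenvector lies in the kernel part, which is therefore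
  -- nonzero.
  obtain ⟨m, hm, hm1⟩ := ((Filter.eventually_all.2 fun i =>
    (aeval (R.Φ i) (X - C lam)).eventually_isCompl_ker_pow_range_pow).and
      (Filter.eventually_ge_atTop 1)).exists
  simp only [← map_pow] at hm
  refine ⟨lam, m, ?_⟩
  have hker : R.IsSubrep fun i => LinearMap.ker (aeval (R.Φ i) ((X - C lam) ^ m)) := by
    refine ⟨fun i x hx => ?_, fun i j h x hx => ?_⟩
    · rw [LinearMap.mem_ker] at hx ⊢
      rw [← aeval_Φ_comm, hx, map_zero]
    · rw [LinearMap.mem_ker] at hx ⊢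
      rw [← aeval_Φ_Q hR, hx, map_zero]
  have hrange : R.IsSubrep fun i => LinearMap.range (aeval (R.Φ i) ((X - C lam) ^ m)) := by
    refine ⟨fun i x hx => ?_, fun i j h x hx => ?_⟩
    · obtain ⟨y, rfl⟩ := hx
      exact ⟨_, (aeval_Φ_comm R i _ y).symm⟩
    · obtain ⟨y, rfl⟩ := hx
      exact ⟨_, (aeval_Φ_Q hR h _ y).symm⟩
  rcases hs _ _ hker hrange hm with h | h
  · have hx0 : x ∈ LinearMap.ker (aeval (R.Φ i) ((X - C lam) ^ m)) := by
      obtain ⟨m, rfl⟩ := Nat.exists_eq_add_of_le' hm1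
      rw [LinearMap.mem_ker, pow_succ, map_mul, Module.End.mul_apply]
      simp [hx.apply_eq_smul]
    rw [h i, Submodule.mem_bot] at hx0
    exact absurd hx0 hx.2
  · exact fun i => LinearMap.range_eq_bot.1 (h i)

end Eigenvalue

section Primary

variable [DecidableRel G.Adj] {R : Rep.{u, v} K G} {P : Fin n → K[X]}

/-- The two orientations of each edge cancel, by tr(AB) = tr(BA) and the antisymmetry of the sign.
-/
theorem sum_trace_eq_zero (hf : R.FinDim) :
    ∑ j, ∑ i : {i // G.Adj j i},
      sgn K G i j * LinearMap.trace K _ (R.Q j i i.2 ∘ₗ R.Q i j i.2.symm) = 0 := by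
  have hf' : ∀ i, FiniteDimensional K (R.V i) := hf
  let t : Fin n → Fin n → K := fun j i => if h : G.Adj j i then
    sgn K G i j * LinearMap.trace K _ (R.Q j i h ∘ₗ R.Q i j h.symm) else 0
  have ht : ∀ j i (h : G.Adj j i),
      t j i = sgn K G i j * LinearMap.trace K _ (R.Q j i h ∘ₗ R.Q i j h.symm) :=
    fun j i h => dif_pos h
  have ht' : ∀ j i, ¬G.Adj j i → t j i = 0 := fun j i h => dif_neg h
  have h1 : ∀ j, ∑ i : {i // G.Adj j i},
      sgn K G i j * LinearMap.trace K _ (R.Q j i i.2 ∘ₗ R.Q i j i.2.symm) = ∑ i, t j i := fun j => by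
    rw [← Finset.sum_congr rfl fun (i : {i // G.Adj j i}) _ => ht j i i.2, sum_subtype_adj]
    refine Finset.sum_congr rfl fun i _ => ?_
    split_ifs with h
    · rfl
    · exact (ht' j i h).symm
  simp only [h1]
  rw [← Fintype.sum_prod_type']
  refine Finset.sum_involution (fun a _ => a.swap) ?_ ?_ (fun _ _ => Finset.mem_univ _)
    (fun _ _ => Prod.swap_swap _)
  · rintro ⟨j, i⟩ -
    by_cases h : G.Adj j i
    · change t j i + t i j = 0
      rw [ht j i h, ht i j h.symm, sgn_symm h.symm, LinearMap.trace_comp_comm']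
      ring
    · change t j i + t i j = 0
      rw [ht' j i h, ht' i j fun h' => h h'.symm, add_zero]
  · rintro ⟨j, i⟩ - hne heq
    rw [Prod.swap_prod_mk, Prod.mk.injEq] at heq
    exact hne (ht' j i fun h => h.ne heq.2)

theorem IsPrimary.isRoot_comb {lam : K} (h : R.IsPrimary lam) (hf : R.FinDim)
    (hR : R.Satisfies P) : (comb P R.dimVec).IsRoot lam := by
  have hf' : ∀ i, FiniteDimensional K (R.V i) := hf
  obtain ⟨m, hm⟩ := h
  have h1 := sum_trace_eq_zero (R := R) hf
  have h2 : ∀ j, ∑ i : {i // G.Adj j i},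
      sgn K G i j * LinearMap.trace K _ (R.Q j i i.2 ∘ₗ R.Q i j i.2.symm) =
        -(Module.finrank K (R.V j) * (P j).eval lam) := fun j => by
    have h := congrArg (LinearMap.trace K (R.V j)) (hR.1 j)
    simp only [map_add, map_sum, map_smul, map_zero, smul_eq_mul, trace_aeval_eq (hm j)] at h
    exact eq_neg_of_add_eq_zero_left h
  simp only [h2, Finset.sum_neg_distrib, neg_eq_zero] at h1
  simpa [comb, dimVec, IsRoot.def, eval_finsetSum] using h1

theorem IsPrimary.reflectGen {lam : K} (h : R.IsPrimary lam) (hP : R.Satisfies P) (k : Fin n) :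
    (reflectGen hP k).IsPrimary lam := by
  obtain ⟨m, hm⟩ := h
  refine ⟨m, fun i => ?_⟩
  let M := reflectGenModel hP k
  ext x
  by_cases hi : i = k
  · subst hi
    obtain ⟨y, rfl⟩ := M.eK.surjective x
    have h1 := map_aeval_apply (Φ := plusΦ hP i)
      (f := (M.eK : R.Plus i →ₗ[K] (Rep.reflectGen hP i).V i)) M.map_plusΦ ((X - C lam) ^ m) y
    have h2 : aeval (plusΦ hP i) ((X - C lam) ^ m) y = 0 := by
      apply Subtype.ext
      rw [coe_aeval_plusΦ]
      funext j
      rw [aeval_nbrΦ_apply, hm]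
      rfl
    rw [h2, map_zero] at h1
    exact h1.symm
  · obtain ⟨y, rfl⟩ := (M.e i hi).surjective x
    have h1 := M.reflectionData.map_aeval i hi ((X - C lam) ^ m) y
    rw [hm, LinearMap.zero_apply, map_zero] at h1
    exact h1.symm

theorem IsScalar.reflectGen {lam : K} (h : R.IsScalar lam) (hP : R.Satisfies P) (k : Fin n) :
    (reflectGen hP k).IsScalar lam := by
  intro i x
  exact reflectGenΦ_apply_of_isScalar hP k h i _ x

/-- The relation at k reduces to P_k(Φ_k) = 0. As λ is a simple root, P_k = (X - λ) q with q(Φ_k)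
invertible, so Φ_k = λ. -/
theorem IsConcentratedAt.isScalar {k : Fin n} (h : R.IsConcentratedAt k) (hR : R.IsNonzero)
    (hP : R.Satisfies P) {lam : K} (hl : R.IsPrimary lam) (hk : ¬HasMultipleRoot (P k)) :
    R.IsScalar lam := by
  have h0 : aeval (R.Φ k) (P k) = 0 := by
    have := hP.1 k
    rwa [Finset.sum_eq_zero, zero_add] at this
    intro i _
    rw [Q_eq_zero_of_isConcentratedAt h, LinearMap.zero_comp, smul_zero]
  have := h.nontrivial hR
  have hroot : (P k).eval lam = 0 := by
    by_contra hne
    obtain ⟨x, hx⟩ := exists_ne (0 : R.V k)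
    apply hx
    apply (hl.bijective (k := k) hne).1
    simp [h0]
  obtain ⟨q, hq⟩ := dvd_iff_isRoot.2 hroot
  have hq0 : q.eval lam ≠ 0 := fun hq0 => hk ⟨lam, by
    rw [hq, pow_two]
    exact mul_dvd_mul_left _ (dvd_iff_isRoot.2 hq0)⟩
  intro i x
  by_cases hi : i = k
  · subst hi
    rw [← sub_eq_zero]
    apply (hl.bijective (k := i) hq0).1
    have h1 := LinearMap.congr_fun h0 x
    rw [hq, mul_comm, map_mul, Module.End.mul_apply] at h1
    simpa using h1
  · have := h i hi
    exact Subsingleton.elim _ _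

/-- Here λ is a common root of the combinations of the P_i with coefficient vectors e_k and dim V,
so genericity makes dim V a multiple of e_k. -/
theorem isConcentratedAt_of_eval_eq_zero (hG : Generic P) (hR : R.IsNonzero) (hf : R.FinDim)
    (hP : R.Satisfies P) {lam : K} (hl : R.IsPrimary lam) {k : Fin n}
    (hk : (P k).eval lam = 0) : R.IsConcentratedAt k := by
  have hk0 : simpleRoot k ≠ 0 := fun h => by
    have := congrFun h k
    simp [simpleRoot] at this
  obtain ⟨c, hc⟩ := hG (simpleRoot k) R.dimVec hk0 (hR.dimVec_ne_zero hf)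
    ⟨lam, by rwa [comb_simpleRoot], hl.isRoot_comb hf hP⟩
  intro i hi
  have := hf i
  have h1 := hc i
  simp only [simpleRoot, Pi.single_eq_of_ne hi, dimVec, Int.cast_zero, mul_zero, Int.cast_natCast,
    Nat.cast_eq_zero] at h1
  exact Module.finrank_zero_iff.1 h1

/-- Reflecting twice at the same vertex gives back the original representation. -/
theorem isIsomorphic_reflectGen_reflectGen {lam : K} (hl : R.IsPrimary lam) (hP : R.Satisfies P)
    {k : Fin n} (hk : (P k).eval lam ≠ 0) :
    R.IsIsomorphic (reflectGen (reflectGenModel hP k).satisfies k) := by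
  set hS := (reflectGenModel hP k).satisfies
  have hT := (reflectGenModel hS k).satisfies
  have hk' : (weylAct (simpleReflection G k) (weylAct (simpleReflection G k) P) k).eval lam ≠ 0 := by
    rwa [weylAct_simpleReflection_involutive]
  have hb := hl.bijective (k := k) hk
  have hb' := ((hl.reflectGen hP k).reflectGen hS k).bijective (k := k) hk'
  have hp : P k = -weylAct (simpleReflection G k) P k := by
    rw [weylAct_simpleReflection_self, neg_neg]
  -- Both V and its double reflection have F_k(V) as a reflection: V directly, the double reflection
  -- by symmetry of the relation.
  refine ReflectionData.isIsomorphic (p := P k) (reflectGenModel hP k).reflectionData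
    (hp ▸ (reflectGenModel hS k).reflectionData.symm)
    ⟨fun i => LinearEquiv.refl K _, fun _ _ => rfl, fun _ _ _ _ => rfl⟩ hP hT
    (hP.outMap_injective k hb) (hT.outMap_injective k hb')
    (hP.inMap_surjective k hb) (hT.inMap_surjective k hb')

theorem sum_dimVec_reflectGen_lt (hf : R.FinDim) (hP : R.Satisfies P) {k : Fin n}
    (hRi : Function.Surjective (R.inMap k)) (hk : 0 < cartan G R.dimVec k) :
    ∑ i, (reflectGen hP k).dimVec i < ∑ i, R.dimVec i := by
  rw [dimVec_reflectGen hP k hf hRi, simpleReflection_eq_sub]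
  simp only [Pi.sub_apply, Pi.smul_apply, Finset.sum_sub_distrib, smul_eq_mul, ← Finset.mul_sum]
  simp [simpleRoot, hk]

end Primary

end Rep

end NOneQuiver

/-! ### Descent on the total dimension -/

namespace NOneQuiver

variable {n : ℕ}

namespace Rep

variable {K : Type u} [Field K] {G : SimpleGraph (Fin n)} [DecidableRel G.Adj]

section Reduction

variable {x : Fin n → ℤ} (hx : ∀ k, 0 < x k) (hC : ∀ k, ∑ l : {i // G.Adj k i}, x l < 2 * x k)
include hx hC

/-- Induction on a strict bound for the total dimension. A vertex k with (dim V, e_k) > 0 either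
carries all of V, when P_k(λ) = 0, or gives a smaller simple F_k(V), from which V returns by
reflecting at k again. -/
theorem exists_isIteratedReflection (N : ℕ) {P : Fin n → K[X]}
    (hsimple : ∀ p ∈ weylPolynomials G P, ¬HasMultipleRoot p) (hG : Generic P)
    {V : Rep.{u, v} K G} {lam : K} (hf : V.FinDim) (hP : V.Satisfies P) (hV : V.IsSimple)
    (hs : V.IsScalar lam) (hN : ∑ i, V.dimVec i < N) :
    ∃ (w : List (Fin n)) (β : Fin n), V.IsIteratedReflection lam β w P ∧
      V.dimVec = w.foldr (fun k d => simpleReflection G k d) (simpleRoot β) := by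
  induction N generalizing P V with
  | zero => exact absurd (Finset.sum_nonneg fun i _ => V.dimVec_nonneg i) (by simpa using hN)
  | succ N ih =>
    obtain ⟨k, hk⟩ := exists_cartan_pos hx hC V.dimVec_nonneg (hV.1.dimVec_ne_zero hf)
    have hl := hs.isPrimary
    by_cases hk0 : (P k).eval lam = 0
    · have hc := isConcentratedAt_of_eval_eq_zero hG hV.1 hf hP hl hk0
      exact ⟨[], k, ⟨hP, hs, hV, hc⟩, hc.dimVec_eq hs hV.isIndecomposable⟩
    · have hb := hl.bijective (k := k) hk0
      let M := reflectGenModel hP k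
      have hWs : (reflectGen hP k).IsScalar lam := hs.reflectGen hP k
      have hk' : (weylAct (simpleReflection G k) P k).eval lam ≠ 0 := by
        rwa [weylAct_simpleReflection_self, eval_neg, neg_ne_zero]
      have hb' := hWs.isPrimary.bijective (k := k) hk'
      have hW : (reflectGen hP k).IsSimple := M.reflectionData.isSimple hP
        (hP.outMap_injective k hb) M.outMap_injective (M.satisfies.inMap_surjective k hb') hV
      have hlt := sum_dimVec_reflectGen_lt hf hP (hP.inMap_surjective k hb) hk
      obtain ⟨w, β, h1, h2⟩ := ih
        (fun p hp => hsimple p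
          (weylPolynomials_weylAct_subset (simpleReflection_mem_weylGroup G k) P hp))
        (hG.weylAct _) (finDim_reflectGen hP k hf) M.satisfies hW hWs (by push_cast at hN; omega)
      refine ⟨k :: w, β, ⟨reflectGen hP k, h1, hW,
        not_isConcentratedAt_of_outMap_injective hW.1 M.outMap_injective,
        M.satisfies, hWs, hk', ?_⟩, ?_⟩
      · exact (isIsomorphic_reflectGen_reflectGen hl hP hk0).trans
          (reflectGen_isIsomorphic_reflect M.satisfies k hWs hk')
      · rw [List.foldr_cons, ← h2, dimVec_reflectGen hP k hf (hP.inMap_surjective k hb),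
          simpleReflection_apply_simpleReflection]

/-- The same descent for indecomposables. Uniqueness rides along: V' shares λ and the dimension
vector with V, so it is reflected at the same vertices and reaches the same one-dimensional
representation. -/
theorem dimVec_mem_orbit_and_isIsomorphic (N : ℕ) {P : Fin n → K[X]}
    (hsimple : ∀ p ∈ weylPolynomials G P, ¬HasMultipleRoot p) (hG : Generic P)
    {V : Rep.{u, v} K G} {lam : K} (hf : V.FinDim) (hP : V.Satisfies P) (hV : V.IsIndecomposable)
    (hl : V.IsPrimary lam) (hN : ∑ i, V.dimVec i < N) :
    (∃ w ∈ weylGroup G, ∃ j, V.dimVec = w (simpleRoot j)) ∧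
      ∀ V' : Rep.{u, v} K G, V'.FinDim → V'.Satisfies P → V'.IsIndecomposable →
        V'.IsPrimary lam → V.dimVec = V'.dimVec → V.IsIsomorphic V' := by
  induction N generalizing P V with
  | zero => exact absurd (Finset.sum_nonneg fun i _ => V.dimVec_nonneg i) (by simpa using hN)
  | succ N ih =>
    obtain ⟨k, hk⟩ := exists_cartan_pos hx hC V.dimVec_nonneg (hV.1.dimVec_ne_zero hf)
    by_cases hk0 : (P k).eval lam = 0
    · have hmult := hsimple _ (mem_weylPolynomials P k)
      have hc := isConcentratedAt_of_eval_eq_zero hG hV.1 hf hP hl hk0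
      have hs := hc.isScalar hV.1 hP hl hmult
      refine ⟨⟨1, one_mem _, k, hc.dimVec_eq hs hV⟩, fun V' hf' hP' hV' hl' hd => ?_⟩
      have hc' := isConcentratedAt_of_eval_eq_zero hG hV'.1 hf' hP' hl' hk0
      exact hc.isIsomorphic hc' hs (hc'.isScalar hV'.1 hP' hl' hmult) hf hf' hd
    · have hb := hl.bijective (k := k) hk0
      let M := reflectGenModel hP k
      have hW : (reflectGen hP k).IsIndecomposable := M.reflectionData.isIndecomposable hP
        (hP.outMap_injective k hb) (hP.inMap_surjective k hb) M.outMap_injective hV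
      have hlt := sum_dimVec_reflectGen_lt hf hP (hP.inMap_surjective k hb) hk
      have hdim := dimVec_reflectGen hP k hf (hP.inMap_surjective k hb)
      obtain ⟨⟨w, hw, j, h1⟩, h2⟩ := ih
        (fun p hp => hsimple p
          (weylPolynomials_weylAct_subset (simpleReflection_mem_weylGroup G k) P hp))
        (hG.weylAct _) (finDim_reflectGen hP k hf) M.satisfies hW (hl.reflectGen hP k)
        (by push_cast at hN; omega)
      refine ⟨⟨simpleReflection G k * w, mul_mem (simpleReflection_mem_weylGroup G k) hw, j, ?_⟩,
        fun V' hf' hP' hV' hl' hd => ?_⟩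
      · rw [LinearEquiv.mul_apply, ← h1, hdim, simpleReflection_apply_simpleReflection]
      · let M' := reflectGenModel hP' k
        have hb' := hl'.bijective (k := k) hk0
        have hW' : (reflectGen hP' k).IsIndecomposable := M'.reflectionData.isIndecomposable hP'
          (hP'.outMap_injective k hb') (hP'.inMap_surjective k hb') M'.outMap_injective hV'
        have hiso := h2 (reflectGen hP' k) (finDim_reflectGen hP' k hf') M'.satisfies hW'
          (hl'.reflectGen hP' k)
          (by rw [hdim, hd, dimVec_reflectGen hP' k hf' (hP'.inMap_surjective k hb')])
        exact M.reflectionData.isIsomorphic M'.reflectionData hiso hP hP'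
          (hP.outMap_injective k hb) (hP'.outMap_injective k hb')
          (hP.inMap_surjective k hb) (hP'.inMap_surjective k hb')

theorem finiteRepresentationType [IsAlgClosed K] {P : Fin n → K[X]}
    (hsimple : ∀ p ∈ weylPolynomials G P, ¬HasMultipleRoot p) (hG : Generic P) :
    FiniteRepresentationType.{u, v} G P := by
  classical
  -- The pairs (dimension vector, eigenvalue) that occur; each determines its indecomposable up to
  -- isomorphism.
  let T : Set ((Fin n → ℤ) × K) := {t | ∃ R : Rep.{u, v} K G, R.FinDim ∧ R.Satisfies P ∧
    R.IsIndecomposable ∧ R.IsPrimary t.2 ∧ R.dimVec = t.1}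
  have hbound : ∀ R : Rep.{u, v} K G, ∃ N : ℕ, ∑ i, R.dimVec i < N := fun R =>
    ⟨(∑ i, R.dimVec i).toNat + 1, by push_cast; omega⟩
  have hT : T.Finite := by
    refine ((finite_roots hx hC).biUnion fun d _ =>
      ((comb P d).roots.toFinset.finite_toSet.image fun lam => (d, lam))).subset ?_
    rintro ⟨d, lam⟩ ⟨R, hf, hP, hR, hl, rfl⟩
    obtain ⟨N, hN⟩ := hbound R
    have horb := (dimVec_mem_orbit_and_isIsomorphic hx hC N hsimple hG hf hP hR hl hN).1
    refine Set.mem_biUnion horb ⟨lam, ?_, rfl⟩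
    obtain ⟨w, hw, j, hd⟩ := horb
    -- The dimension vector is a root w e_j, so this polynomial is w(P)_j. It is nonzero because the
    -- zero polynomial counts as having multiple roots, hence it has finitely many roots λ.
    have hne : comb P R.dimVec ≠ 0 := fun h0 =>
      hsimple _ ⟨w, hw, j, rfl⟩ ⟨0, by rw [weylAct, ← hd, h0]; exact dvd_zero _⟩
    rw [SetLike.mem_coe, Multiset.mem_toFinset, mem_roots hne]
    exact hl.isRoot_comb hf hP
  have : Finite T := hT
  obtain ⟨N, ⟨e⟩⟩ := Finite.exists_equiv_fin T
  choose S hS using fun t : T => t.2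
  refine ⟨N, fun a => S (e.symm a), fun R hf hP hR => ?_⟩
  obtain ⟨lam, hl⟩ := hR.exists_isPrimary hf hP
  let t : T := ⟨(R.dimVec, lam), R, hf, hP, hR, hl, rfl⟩
  refine ⟨e t, ?_⟩
  beta_reduce
  rw [e.symm_apply_apply]
  obtain ⟨h1, h2, h3, h4, h5⟩ := hS t
  obtain ⟨M, hM⟩ := hbound R
  exact (dimVec_mem_orbit_and_isIsomorphic hx hC M hsimple hG hf hP hR hl hM).2 _ h1 h2 h3 h4 h5.symm

end Reduction

theorem isPositiveRoot_dimVec {V : Rep.{u, v} K G} {w : List (Fin n)} {β : Fin n}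
    (h : V.dimVec = w.foldr (fun k d => simpleReflection G k d) (simpleRoot β)) :
    IsPositiveRoot G V.dimVec := by
  refine ⟨?_, V.dimVec_nonneg⟩
  rw [h]
  clear h
  induction w with
  | nil => exact ⟨1, one_mem _, β, rfl⟩
  | cons k w ih =>
    obtain ⟨v, hv, j, h⟩ := ih
    exact ⟨simpleReflection G k * v, mul_mem (simpleReflection_mem_weylGroup G k) hv, j, by
      rw [List.foldr_cons, h, LinearEquiv.mul_apply]⟩

end Rep

end NOneQuiver

theorem mainTheorem1 {K : Type u} [Field K] [IsAlgClosed K] (Γ : ADEDiagram)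
    (P : Fin Γ.rank → K[X])
    (hsimple : ∀ p ∈ NOneQuiver.weylPolynomials Γ.graph P, ¬ NOneQuiver.HasMultipleRoot p)
    (hgeneric : NOneQuiver.Generic P) :
    NOneQuiver.Rep.FiniteRepresentationType.{u, v} Γ.graph P ∧
    ∀ V : NOneQuiver.Rep.{u, v} K Γ.graph, V.FinDim → V.Satisfies P → V.IsSimple →
      ∃ (lam : K) (w : List (Fin Γ.rank)) (β : Fin Γ.rank),
        V.IsIteratedReflection lam β w P ∧
        V.dimVec = w.foldr (fun k d => NOneQuiver.simpleReflection Γ.graph k d)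
          (NOneQuiver.simpleRoot β) ∧
        NOneQuiver.IsPositiveRoot Γ.graph V.dimVec := by
  refine ⟨NOneQuiver.Rep.finiteRepresentationType Γ.weight_pos Γ.sum_adj_weight_lt hsimple hgeneric,
    fun V hf hP hV => ?_⟩
  obtain ⟨lam, hs⟩ := hV.exists_isScalar hf hP
  obtain ⟨w, β, h1, h2⟩ := NOneQuiver.Rep.exists_isIteratedReflection Γ.weight_pos
    Γ.sum_adj_weight_lt ((∑ i, V.dimVec i).toNat + 1) hsimple hgeneric hf hP hV hs
    (by push_cast; omega)
  exact ⟨lam, w, β, h1, h2, NOneQuiver.Rep.isPositiveRoot_dimVec h2⟩
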